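/- Let $r \ge 3$ and $d \ge 0$ be integers, let $\epsilon_1,\dots,\epsilon_r$ be the standard basis of $\Gamma=\mathbb{Z}^r$, and let $$\Delta_{B_r}=\{\pm\epsilon_i\pm\epsilon_j : i\ne j\}\cup\{\pm\epsilon_i\},\qquad \Delta=\Delta_{B_r}\cup\{\pm2\epsilon_i\}$$ be the root systems of types $B_r$ and $BC_r$. Let $(\alpha_1,\dots,\alpha_r)$ be an ordered base of $\Delta_{B_r}$, let $\alpha_{r+1},\dots,\alpha_{r+d}$ be any long roots $\pm\epsilon_i\pm\epsilon_j$ ($i\neq j$) of $\Delta_{B_r}$ (repetitions allowed), and put $A^{[d]}_{ij}=2(\alpha_i,\alpha_j)/(\alpha_i,\alpha_i)$ for $1\le i,j\le r+d$, where $(\cdot,\cdot)$ is the Killing form (equivalently, the standard inner product). Write $M=A^{[d]}$, and let $\mathfrak{gim}(A^{[d]})$ be the complex Lie algebra with generators $e_i,f_i,h_i$ ($1\le i\le r+d$) and relations - for all $i,j$: $[h_i,e_j]=M_{ij}e_j$, $[h_i,f_j]=-M_{ij}f_j$, $[e_i,f_i]=h_i$; - if $M_{ij}\le 0$: $[e_i,f_j]=0=[f_i,e_j]$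 and $(\operatorname{ad} e_i)^{-M_{ij}+1}e_j=0=(\operatorname{ad} f_i)^{-M_{ij}+1}f_j$; - if $M_{ij}>0$ and $i\ne j$: $[e_i,e_j]=0=[f_i,f_j]$ and $(\operatorname{ad} e_i)^{M_{ij}+1}f_j=0=(\operatorname{ad} f_i)^{M_{ij}+1}e_j$. Grade $\mathfrak{gim}(A^{[d]})$ by $\Gamma$ with $\deg e_i=\alpha_i=-\deg f_i$ and $\deg h_i=0$, let $\mathfrak r$ be the ideal generated by all homogeneous components $\mathfrak{gim}(A^{[d]})_\gamma$ with $\gamma\notin\Delta\cup\{0\}$, and put $\mathfrak{im}(A^{[d]})=\mathfrak{gim}(A^{[d]})/\mathfrak r$. Then $L=\mathfrak{im}(A^{[d]})$ is $BC_r$-graded with a grading subalgebra of type $B_r$, that is: (i) $L$ contains, as a subalgebra, a finite-dimensional simple Lie algebra $\mathfrak g$ whose root system relative to a Cartan subalgebra $\mathfrak h$ of $\mathfrak g$ is $\Delta_{B_r}$ (with $\epsilon_1,\dots,\epsilon_r$ identified with a basis of $\mathfrak h^*$); (ii) $L=\bigoplus_{\mu\in\Delta\cup\{0\}}L_\mu$,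 where $L_\mu=\{x\in L : [h,x]=\mu(h)x \text{ for all } h\in\mathfrak h\}$; (iii) $L_0=\sum_{\mu\in\Delta}[L_\mu,L_{-\mu}]$. -/

import Mathlib

noncomputable section

namespace IMAlg

/-! ### Root systems of types `B_r` and `BC_r` -/

/-- The lattice `Γ = ℤ ε_1 ⊕ ⋯ ⊕ ℤ ε_r` generated by the root system of type `BC_r`. -/
abbrev Lattice (r : ℕ) : Type := Fin r → ℤ

/-- The basis vector `ε_i` of the lattice. -/
def eps {r : ℕ} (i : Fin r) : Lattice r := Pi.single i 1

/-- The long roots `±ε_i ± ε_j` (`i ≠ j`) of `Δ_{B_r}`. -/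
def longRoots (r : ℕ) : Set (Lattice r) :=
  {v | ∃ i j : Fin r, i ≠ j ∧ ∃ s t : ℤˣ, v = (s : ℤ) • eps i + (t : ℤ) • eps j}

/-- The short roots `±ε_i` of `Δ_{B_r}`. -/
def shortRoots (r : ℕ) : Set (Lattice r) :=
  {v | ∃ i : Fin r, ∃ s : ℤˣ, v = (s : ℤ) • eps i}

/-- The elements `±2ε_i` of the root system of type `BC_r`. -/
def extraLongRoots (r : ℕ) : Set (Lattice r) :=
  {v | ∃ i : Fin r, ∃ s : ℤˣ, v = (2 * (s : ℤ)) • eps i}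

/-- The root system `Δ_{B_r}`. -/
def rootsB (r : ℕ) : Set (Lattice r) := longRoots r ∪ shortRoots r

/-- The root system `Δ` of type `BC_r`. -/
def rootsBC (r : ℕ) : Set (Lattice r) := longRoots r ∪ shortRoots r ∪ extraLongRoots r

/-- An ordered base `(α_1, …, α_r)` of `Δ_{B_r}`: linearly independent roots such that every root
is a combination of them with integer coefficients all nonnegative or all nonpositive. -/
structure IsBaseB {r : ℕ} (α : Fin r → Lattice r) : Prop where
  mem : ∀ i, α i ∈ rootsB r
  linearIndependent : LinearIndependent ℤ α
  pos_or_neg : ∀ β ∈ rootsB r, ∃ c : Fin r → ℕ, β = ∑ i, c i • α i ∨ β = -∑ i, c i • α i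

/-- The matrix `A_{ij} = 2 (δ_i, δ_j) / (δ_i, δ_i)` of a family of roots of `Δ_{B_r}`. On
`Δ_{B_r}` the Killing form is a nonzero multiple of the standard inner product, so it gives the
same ratios; for roots of `Δ_{B_r}` the division is exact, see `intersectionMatrix_mul`. -/
def intersectionMatrix {r : ℕ} {ι : Type*} (δ : ι → Lattice r) : Matrix ι ι ℤ :=
  Matrix.of fun i j => 2 * (δ i ⬝ᵥ δ j) / (δ i ⬝ᵥ δ i)

theorem dotProduct_self_of_mem_rootsB {r : ℕ} {v : Lattice r} (hv : v ∈ rootsB r) :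
    v ⬝ᵥ v = 1 ∨ v ⬝ᵥ v = 2 := by
  rcases hv with ⟨i, j, hij, s, t, rfl⟩ | ⟨i, s, rfl⟩
  · right
    rcases Int.units_eq_one_or s with rfl | rfl <;> rcases Int.units_eq_one_or t with rfl | rfl <;>
      simp [eps, hij, hij.symm]
  · left
    rcases Int.units_eq_one_or s with rfl | rfl <;> simp [eps]

theorem intersectionMatrix_mul {r : ℕ} {ι : Type*} {δ : ι → Lattice r}
    (hδ : ∀ i, δ i ∈ rootsB r) (i j : ι) :
    intersectionMatrix δ i j * (δ i ⬝ᵥ δ i) = 2 * (δ i ⬝ᵥ δ j) := by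
  rcases dotProduct_self_of_mem_rootsB (hδ i) with h | h <;>
    simp [intersectionMatrix, h, mul_comm]

/-! ### Generalized intersection matrices and their algebras -/

/-- Generalized intersection matrices. -/
structure IsGIM {ι : Type*} (M : Matrix ι ι ℤ) : Prop where
  diag : ∀ i, M i i = 2
  neg_iff : ∀ i j, i ≠ j → (M i j < 0 ↔ M j i < 0)
  pos_iff : ∀ i j, i ≠ j → (0 < M i j ↔ 0 < M j i)

/-- The matrix of a family of roots of `Δ_{B_r}` is a generalized intersection matrix. -/
theorem isGIM_intersectionMatrix {r : ℕ} {ι : Type*} {δ : ι → Lattice r}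
    (hδ : ∀ i, δ i ∈ rootsB r) : IsGIM (intersectionMatrix δ) := by
  have key := intersectionMatrix_mul hδ
  have hc : ∀ i j, δ i ⬝ᵥ δ j = δ j ⬝ᵥ δ i := fun i j => dotProduct_comm _ _
  refine ⟨fun i => ?_, fun i j _ => ?_, fun i j _ => ?_⟩
  · have h := key i i
    rcases dotProduct_self_of_mem_rootsB (hδ i) with h1 | h1 <;> rw [h1] at h <;> omega
  all_goals
    have h := key i j
    have h' := key j i
    rw [hc j i] at h'
    rcases dotProduct_self_of_mem_rootsB (hδ i) with h1 | h1 <;>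
      rcases dotProduct_self_of_mem_rootsB (hδ j) with h2 | h2 <;>
      rw [h1] at h <;> rw [h2] at h' <;> omega

section Gim

variable {ι : Type*}

/-- The generator `e_i` of the free Lie algebra. -/
abbrev freeE (i : ι) : FreeLieAlgebra ℂ (CartanMatrix.Generators ι) :=
  FreeLieAlgebra.of ℂ (CartanMatrix.Generators.E i)

/-- The generator `f_i` of the free Lie algebra. -/
abbrev freeF (i : ι) : FreeLieAlgebra ℂ (CartanMatrix.Generators ι) :=
  FreeLieAlgebra.of ℂ (CartanMatrix.Generators.F i)

/-- The generator `h_i` of the free Lie algebra. -/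
abbrev freeH (i : ι) : FreeLieAlgebra ℂ (CartanMatrix.Generators ι) :=
  FreeLieAlgebra.of ℂ (CartanMatrix.Generators.H i)

/-- The elements of the free Lie algebra that the defining relations of `gim(M)` set to zero. -/
inductive GimRelator (M : Matrix ι ι ℤ) : FreeLieAlgebra ℂ (CartanMatrix.Generators ι) → Prop
  | he (i j : ι) : GimRelator M (⁅freeH i, freeE j⁆ - (M i j : ℂ) • freeE j)
  | hf (i j : ι) : GimRelator M (⁅freeH i, freeF j⁆ + (M i j : ℂ) • freeF j)
  | ef (i : ι) : GimRelator M (⁅freeE i, freeF i⁆ - freeH i)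
  | nonpos_ef (i j : ι) (h : M i j ≤ 0) : GimRelator M ⁅freeE i, freeF j⁆
  | nonpos_fe (i j : ι) (h : M i j ≤ 0) : GimRelator M ⁅freeF i, freeE j⁆
  | nonpos_ad_e (i j : ι) (h : M i j ≤ 0) :
      GimRelator M ((LieAlgebra.ad ℂ _ (freeE i) ^ ((-M i j).toNat + 1)) (freeE j))
  | nonpos_ad_f (i j : ι) (h : M i j ≤ 0) :
      GimRelator M ((LieAlgebra.ad ℂ _ (freeF i) ^ ((-M i j).toNat + 1)) (freeF j))
  | pos_ee (i j : ι) (h : 0 < M i j) (hij : i ≠ j) : GimRelator M ⁅freeE i, freeE j⁆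
  | pos_ff (i j : ι) (h : 0 < M i j) (hij : i ≠ j) : GimRelator M ⁅freeF i, freeF j⁆
  | pos_ad_e (i j : ι) (h : 0 < M i j) (hij : i ≠ j) :
      GimRelator M ((LieAlgebra.ad ℂ _ (freeE i) ^ ((M i j).toNat + 1)) (freeF j))
  | pos_ad_f (i j : ι) (h : 0 < M i j) (hij : i ≠ j) :
      GimRelator M ((LieAlgebra.ad ℂ _ (freeF i) ^ ((M i j).toNat + 1)) (freeE j))

/-- The ideal of the free Lie algebra generated by the relators. -/
def gimIdeal (M : Matrix ι ι ℤ) : LieIdeal ℂ (FreeLieAlgebra ℂ (CartanMatrix.Generators ι)) :=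
  LieSubmodule.lieSpan ℂ _ {x | GimRelator M x}

/-- The generalized intersection matrix algebra `gim(M)`, given by generators and relations. -/
abbrev Gim (M : Matrix ι ι ℤ) : Type _ :=
  FreeLieAlgebra ℂ (CartanMatrix.Generators ι) ⧸ gimIdeal M

/-- The generator `e_i` of `gim(M)`. -/
def gimE (M : Matrix ι ι ℤ) (i : ι) : Gim M := LieSubmodule.Quotient.mk (freeE i)

/-- The generator `f_i` of `gim(M)`. -/
def gimF (M : Matrix ι ι ℤ) (i : ι) : Gim M := LieSubmodule.Quotient.mk (freeF i)

/-- The generator `h_i` of `gim(M)`. -/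
def gimH (M : Matrix ι ι ℤ) (i : ι) : Gim M := LieSubmodule.Quotient.mk (freeH i)

end Gim

/-! ### The intersection matrix algebra -/

section Im

variable {r : ℕ} {ι : Type*} (δ : ι → Lattice r)

/-- `HasDegree δ γ x`: the element `x` of `gim` lies in the component of degree `γ` of the
`Γ`-grading with `deg e_i = δ_i = -deg f_i` and `deg h_i = 0`; that is, `x` is a linear combination
of iterated brackets of generators of total degree `γ`. -/
inductive HasDegree : Lattice r → Gim (intersectionMatrix δ) → Prop
  | e (i : ι) : HasDegree (δ i) (gimE _ i)
  | f (i : ι) : HasDegree (-δ i) (gimF _ i)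
  | h (i : ι) : HasDegree 0 (gimH _ i)
  | zero (γ : Lattice r) : HasDegree γ 0
  | add {γ : Lattice r} {x y : Gim (intersectionMatrix δ)} :
      HasDegree γ x → HasDegree γ y → HasDegree γ (x + y)
  | smul {γ : Lattice r} (c : ℂ) {x : Gim (intersectionMatrix δ)} :
      HasDegree γ x → HasDegree γ (c • x)
  | lie {γ γ' : Lattice r} {x y : Gim (intersectionMatrix δ)} :
      HasDegree γ x → HasDegree γ' y → HasDegree (γ + γ') ⁅x, y⁆

/-- The root space `gim_γ`. -/
def gimRootSpace (γ : Lattice r) : Submodule ℂ (Gim (intersectionMatrix δ)) where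
  carrier := {x | HasDegree δ γ x}
  add_mem' := HasDegree.add
  zero_mem' := HasDegree.zero γ
  smul_mem' c _ := HasDegree.smul c

/-- The radical of `gim`: the ideal generated by the root spaces `gim_γ` with
`γ ∉ Δ ∪ {0}`, where `Δ` is the root system of type `BC_r`. -/
def radical : LieIdeal ℂ (Gim (intersectionMatrix δ)) :=
  LieSubmodule.lieSpan ℂ _ {x | ∃ γ : Lattice r, γ ∉ rootsBC r ∪ {0} ∧ x ∈ gimRootSpace δ γ}

/-- The intersection matrix algebra `im`, the quotient of `gim` by its radical. -/
abbrev Im : Type _ := Gim (intersectionMatrix δ) ⧸ radical δ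

end Im

/-! ### Lie algebras graded by the root system `BC_r` -/

section Graded

variable {L : Type*} [LieRing L] [LieAlgebra ℂ L]

/-- The linear functional `μ_1 ε_1 + ⋯ + μ_r ε_r` on `H` attached to an element `μ` of the
lattice, once a basis `ε` of the dual of `H` is given. -/
def toFunctional {r : ℕ} {H : Type*} [AddCommGroup H] [Module ℂ H]
    (ε : Module.Basis (Fin r) ℂ (Module.Dual ℂ H)) (μ : Lattice r) : Module.Dual ℂ H :=
  ∑ i, μ i • ε i

/-- The weight space `L_φ = {x ∈ L | [h, x] = φ(h) x for all h ∈ H}` of `L`, for a subalgebra `H`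
of a subalgebra `g` of `L`. -/
def weightSpace {g : LieSubalgebra ℂ L} (H : LieSubalgebra ℂ g) (φ : Module.Dual ℂ H) :
    Submodule ℂ L where
  carrier := {x | ∀ h : H, ⁅((h : g) : L), x⁆ = φ h • x}
  add_mem' hx hy h := by rw [lie_add, hx h, hy h, smul_add]
  zero_mem' h := by rw [lie_zero, smul_zero]
  smul_mem' c x hx h := by rw [lie_smul, hx h, smul_comm]

/-- The span of all brackets `[x, y]` with `x ∈ U` and `y ∈ V`. -/
def bracketSpan (U V : Submodule ℂ L) : Submodule ℂ L :=
  Submodule.span ℂ {z | ∃ x ∈ U, ∃ y ∈ V, ⁅x, y⁆ = z}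

/-- The root system of `g` relative to the Cartan subalgebra `H` is `Δ_{B_r}`, where `ε` (a basis
of the dual of `H`) plays the role of `ε_1, …, ε_r`. -/
def HasRootSystemB {r : ℕ} {g : Type*} [LieRing g] [LieAlgebra ℂ g] (H : LieSubalgebra ℂ g)
    [H.IsCartanSubalgebra] (ε : Module.Basis (Fin r) ℂ (Module.Dual ℂ H)) : Prop :=
  {φ : Module.Dual ℂ H | φ ≠ 0 ∧ LieAlgebra.rootSpace H φ ≠ ⊥} = toFunctional ε '' rootsB r

/-- `L` is `BC_r`-graded with the grading subalgebra `g` of type `B_r`, relative to the Cartan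
subalgebra `H` of `g` and the identification of the root system of `g` with `Δ_{B_r}` by `ε`. -/
structure IsBCGradedBy (r : ℕ) (g : LieSubalgebra ℂ L) (H : LieSubalgebra ℂ g)
    [H.IsCartanSubalgebra] (ε : Module.Basis (Fin r) ℂ (Module.Dual ℂ H)) : Prop where
  finite : Module.Finite ℂ g
  simple : LieAlgebra.IsSimple ℂ g
  rootSystem : HasRootSystemB H ε
  decomposition : DirectSum.IsInternal
    fun μ : ↥(rootsBC r ∪ {0}) => weightSpace H (toFunctional ε (μ : Lattice r))
  zero_space : weightSpace H (0 : Module.Dual ℂ H) =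
    ⨆ μ ∈ rootsBC r,
      bracketSpan (weightSpace H (toFunctional ε μ)) (weightSpace H (toFunctional ε (-μ)))

/-- `L` is `BC_r`-graded with a grading subalgebra of type `B_r`. -/
def IsBCGraded (r : ℕ) (L : Type*) [LieRing L] [LieAlgebra ℂ L] : Prop :=
  ∃ (g : LieSubalgebra ℂ L) (H : LieSubalgebra ℂ g) (_ : H.IsCartanSubalgebra)
    (ε : Module.Basis (Fin r) ℂ (Module.Dual ℂ H)), IsBCGradedBy r g H ε

end Graded

end IMAlg

end

noncomputable section

namespace IMAlg

/-! ### Combinatorics of the root system `B_r` -/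

section Roots

variable {r : ℕ}

theorem eps_apply (i j : Fin r) : (eps i : Lattice r) j = if j = i then 1 else 0 := by
  simp [eps, Pi.single_apply]

theorem dotProduct_eps (v : Lattice r) (i : Fin r) : v ⬝ᵥ eps i = v i := by simp [eps]

theorem eps_dotProduct (v : Lattice r) (i : Fin r) : eps i ⬝ᵥ v = v i := by simp [eps]

theorem dotProduct_self_eq_zero_iff {v : Lattice r} : v ⬝ᵥ v = 0 ↔ v = 0 :=
  dotProduct_self_eq_zero

theorem dotProduct_self_nonneg' (v : Lattice r) : 0 ≤ v ⬝ᵥ v :=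
  Finset.sum_nonneg fun i _ => mul_self_nonneg (v i)

theorem sq_apply_le_dotProduct_self (v : Lattice r) (i : Fin r) : v i * v i ≤ v ⬝ᵥ v :=
  Finset.single_le_sum (f := fun i => v i * v i) (fun i _ => mul_self_nonneg (v i))
    (Finset.mem_univ i)

/-- A nonzero vector of norm at most `2` splits off a vector `±ε_i`. -/
theorem exists_eq_smul_eps_add {v : Lattice r} (hv : v ≠ 0) (h : v ⬝ᵥ v ≤ 2) :
    ∃ (i : Fin r) (s : ℤˣ) (w : Lattice r), v = (s : ℤ) • eps i + w ∧ w i = 0 ∧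
      w ⬝ᵥ w = v ⬝ᵥ v - 1 := by
  obtain ⟨i, hi⟩ := Function.ne_iff.mp hv
  have h1 := sq_apply_le_dotProduct_self v i
  simp only [Pi.zero_apply] at hi
  have h2 : v i = 1 ∨ v i = -1 := by
    have : v i < 2 := by nlinarith
    have : -2 < v i := by nlinarith
    omega
  obtain ⟨s, hs⟩ : ∃ s : ℤˣ, (s : ℤ) = v i := by
    rcases h2 with h2 | h2
    · exact ⟨1, by simp [h2]⟩
    · exact ⟨-1, by simp [h2]⟩
  refine ⟨i, s, v - (s : ℤ) • eps i, by abel, by simp [eps_apply, hs], ?_⟩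
  simp only [sub_dotProduct, dotProduct_sub, smul_dotProduct, dotProduct_smul, dotProduct_eps,
    eps_dotProduct, hs, smul_eq_mul, eps_apply, if_true]
  rcases h2 with h2 | h2 <;> rw [h2] <;> ring

theorem mem_rootsB_iff {v : Lattice r} : v ∈ rootsB r ↔ v ⬝ᵥ v = 1 ∨ v ⬝ᵥ v = 2 := by
  refine ⟨dotProduct_self_of_mem_rootsB, fun h => ?_⟩
  have hv : v ≠ 0 := by rintro rfl; simp at h
  obtain ⟨i, s, w, rfl, hwi, hw⟩ := exists_eq_smul_eps_add hv (by omega)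
  rcases h with h | h
  · rw [h, sub_self, dotProduct_self_eq_zero_iff] at hw
    subst hw
    exact Or.inr ⟨i, s, by simp⟩
  · rw [h, show (2 : ℤ) - 1 = 1 by norm_num] at hw
    have hw0 : w ≠ 0 := by rintro rfl; simp at hw
    obtain ⟨j, t, u, rfl, -, hu⟩ := exists_eq_smul_eps_add hw0 (by omega)
    rw [hw, sub_self, dotProduct_self_eq_zero_iff] at hu
    subst hu
    refine Or.inl ⟨i, j, ?_, s, t, by simp⟩
    rintro rfl
    simp [eps_apply] at hwi

theorem ne_zero_of_mem_rootsB {v : Lattice r} (hv : v ∈ rootsB r) : v ≠ 0 := by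
  rintro rfl
  simp [mem_rootsB_iff] at hv

theorem eps_mem_rootsB (i : Fin r) : (eps i : Lattice r) ∈ rootsB r := by
  rw [mem_rootsB_iff, dotProduct_eps, eps_apply]
  simp

theorem neg_mem_rootsB {v : Lattice r} (hv : v ∈ rootsB r) : -v ∈ rootsB r := by
  rw [mem_rootsB_iff] at *
  simpa using hv

theorem rootsB_subset_rootsBC : rootsB r ⊆ rootsBC r := Set.subset_union_left

theorem mem_rootsBC_iff {v : Lattice r} :
    v ∈ rootsBC r ↔ v ∈ rootsB r ∨ ∃ w ∈ shortRoots r, v = 2 • w := by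
  refine or_congr Iff.rfl ⟨?_, ?_⟩
  · rintro ⟨i, s, rfl⟩
    exact ⟨_, ⟨i, s, rfl⟩, by rw [mul_smul]; norm_cast⟩
  · rintro ⟨_, ⟨i, s, rfl⟩, rfl⟩
    exact ⟨i, s, by rw [mul_smul]; norm_cast⟩

theorem ne_zero_of_mem_rootsBC {v : Lattice r} (hv : v ∈ rootsBC r) : v ≠ 0 := by
  rcases mem_rootsBC_iff.mp hv with hv | ⟨w, hw, rfl⟩
  · exact ne_zero_of_mem_rootsB hv
  · exact smul_ne_zero two_ne_zero (ne_zero_of_mem_rootsB (Or.inr hw))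

theorem dotProduct_self_le_of_mem_rootsBC {v : Lattice r} (hv : v ∈ rootsBC r) : v ⬝ᵥ v ≤ 4 := by
  rcases mem_rootsBC_iff.mp hv with hv | ⟨w, ⟨i, s, rfl⟩, rfl⟩
  · rcases mem_rootsB_iff.mp hv with h | h <;> omega
  · simp only [smul_dotProduct, dotProduct_smul, dotProduct_eps, eps_apply]
    rcases Int.units_eq_one_or s with rfl | rfl <;> simp

theorem finite_rootsBC : (rootsBC r).Finite := by
  refine (Set.finite_Icc (fun _ => -2 : Lattice r) (fun _ => 2)).subset fun v hv => ?_
  have h := dotProduct_self_le_of_mem_rootsBC hv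
  have h2 := fun i => (sq_apply_le_dotProduct_self v i).trans h
  exact ⟨fun i => by show -2 ≤ v i; nlinarith [h2 i], fun i => by show v i ≤ 2; nlinarith [h2 i]⟩

/-- The pairing of a vector with the coroot of `a`. -/
def corootPairing (a v : Lattice r) : ℤ := 2 * (a ⬝ᵥ v) / (a ⬝ᵥ a)

theorem corootPairing_mul {a : Lattice r} (ha : a ∈ rootsB r) (v : Lattice r) :
    corootPairing a v * (a ⬝ᵥ a) = 2 * (a ⬝ᵥ v) := by
  rcases mem_rootsB_iff.mp ha with h | h <;> simp [corootPairing, h, mul_comm]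

theorem dotProduct_self_pos {a : Lattice r} (ha : a ∈ rootsB r) : 0 < a ⬝ᵥ a := by
  rcases mem_rootsB_iff.mp ha with h | h <;> omega

theorem corootPairing_eq_of_mul {a : Lattice r} (ha : a ∈ rootsB r) {v : Lattice r} {m : ℤ}
    (h : m * (a ⬝ᵥ a) = 2 * (a ⬝ᵥ v)) : corootPairing a v = m :=
  mul_right_cancel₀ (dotProduct_self_pos ha).ne' ((corootPairing_mul ha v).trans h.symm)

theorem corootPairing_add {a : Lattice r} (ha : a ∈ rootsB r) (v w : Lattice r) :
    corootPairing a (v + w) = corootPairing a v + corootPairing a w :=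
  corootPairing_eq_of_mul ha <| by
    rw [add_mul, corootPairing_mul ha, corootPairing_mul ha, dotProduct_add, mul_add]

theorem corootPairing_zsmul {a : Lattice r} (ha : a ∈ rootsB r) (n : ℤ) (v : Lattice r) :
    corootPairing a (n • v) = n * corootPairing a v :=
  corootPairing_eq_of_mul ha <| by
    rw [mul_assoc, corootPairing_mul ha, dotProduct_smul, smul_eq_mul]; ring

theorem corootPairing_neg {a : Lattice r} (ha : a ∈ rootsB r) (v : Lattice r) :
    corootPairing a (-v) = -corootPairing a v := by
  simpa using corootPairing_zsmul ha (-1) v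

theorem corootPairing_zero (a : Lattice r) : corootPairing a 0 = 0 := by
  simp [corootPairing]

theorem corootPairing_self {a : Lattice r} (ha : a ∈ rootsB r) : corootPairing a a = 2 :=
  corootPairing_eq_of_mul ha rfl

theorem corootPairing_eq_zero_iff {a : Lattice r} (ha : a ∈ rootsB r) {v : Lattice r} :
    corootPairing a v = 0 ↔ a ⬝ᵥ v = 0 := by
  have h := corootPairing_mul ha v
  have h2 := dotProduct_self_pos ha
  constructor
  · intro h0; rw [h0] at h; omega
  · intro h0; exact corootPairing_eq_of_mul ha (by rw [h0]; ring)

theorem corootPairing_pos_iff {a : Lattice r} (ha : a ∈ rootsB r) {v : Lattice r} :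
    0 < corootPairing a v ↔ 0 < a ⬝ᵥ v := by
  have h := corootPairing_mul ha v
  have h2 := dotProduct_self_pos ha
  constructor
  · intro h0; nlinarith
  · intro h0; by_contra hc; nlinarith

theorem corootPairing_neg_left {a : Lattice r} (ha : a ∈ rootsB r) (v : Lattice r) :
    corootPairing (-a) v = -corootPairing a v :=
  corootPairing_eq_of_mul (neg_mem_rootsB ha) <| by
    have := corootPairing_mul ha v
    simp only [neg_dotProduct, dotProduct_neg, neg_neg]
    linarith

/-- The reflection in the hyperplane orthogonal to `a`. -/
def reflect (a v : Lattice r) : Lattice r := v - corootPairing a v • a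

theorem reflect_reflect {a : Lattice r} (ha : a ∈ rootsB r) (v : Lattice r) :
    reflect a (reflect a v) = v := by
  have : corootPairing a (reflect a v) = -corootPairing a v := by
    rw [reflect, sub_eq_add_neg, corootPairing_add ha, corootPairing_neg ha,
      corootPairing_zsmul ha, corootPairing_self ha]; ring
  rw [reflect, this, reflect]
  module

theorem reflect_neg {a : Lattice r} (ha : a ∈ rootsB r) (v : Lattice r) :
    reflect a (-v) = -reflect a v := by
  rw [reflect, reflect, corootPairing_neg ha]
  module

theorem reflect_smul {a : Lattice r} (ha : a ∈ rootsB r) (n : ℤ) (v : Lattice r) :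
    reflect a (n • v) = n • reflect a v := by
  rw [reflect, reflect, corootPairing_zsmul ha]
  module

theorem reflect_self {a : Lattice r} (ha : a ∈ rootsB r) : reflect a a = -a := by
  rw [reflect, corootPairing_self ha]
  module

theorem dotProduct_reflect_self {a : Lattice r} (ha : a ∈ rootsB r) (v : Lattice r) :
    reflect a v ⬝ᵥ reflect a v = v ⬝ᵥ v := by
  have h := corootPairing_mul ha v
  simp only [reflect, sub_dotProduct, dotProduct_sub, smul_dotProduct, dotProduct_smul, smul_eq_mul,
    dotProduct_comm v a]
  linear_combination (corootPairing a v) * h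

theorem reflect_mem_rootsB {a v : Lattice r} (ha : a ∈ rootsB r) (hv : v ∈ rootsB r) :
    reflect a v ∈ rootsB r := by
  rw [mem_rootsB_iff, dotProduct_reflect_self ha]
  exact mem_rootsB_iff.mp hv

end Roots

/-! ### Bases of `B_r` -/

namespace IsBaseB

variable {r : ℕ} {α : Fin r → Lattice r}

theorem span_eq_top (hα : IsBaseB α) : Submodule.span ℤ (Set.range α) = ⊤ := by
  have key : ∀ c : Fin r → ℕ, ∑ i, c i • α i ∈ Submodule.span ℤ (Set.range α) := fun c =>
    Submodule.sum_mem _ fun i _ => nsmul_mem (Submodule.subset_span (Set.mem_range_self i)) _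
  refine eq_top_iff.mpr fun v _ => ?_
  have hv : v = ∑ i, v i • eps i := by
    ext j
    simp [eps_apply]
  rw [hv]
  refine Submodule.sum_mem _ fun i _ => Submodule.smul_mem _ _ ?_
  obtain ⟨c, h | h⟩ := hα.pos_or_neg _ (eps_mem_rootsB i) <;> rw [h]
  · exact key c
  · exact neg_mem (key c)

/-- A base of `B_r` as a basis of the lattice. -/
def basis (hα : IsBaseB α) : Module.Basis (Fin r) ℤ (Lattice r) :=
  Module.Basis.mk hα.linearIndependent hα.span_eq_top.ge

@[simp] theorem basis_apply (hα : IsBaseB α) (i : Fin r) : hα.basis i = α i := by simp [basis]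

theorem repr_self (hα : IsBaseB α) (i j : Fin r) :
    hα.basis.repr (α i) j = if i = j then 1 else 0 := by
  rw [← hα.basis_apply i, Module.Basis.repr_self, Finsupp.single_apply]

theorem sum_repr (hα : IsBaseB α) (v : Lattice r) : ∑ i, hα.basis.repr v i • α i = v := by
  simpa using hα.basis.sum_repr v

theorem repr_nonneg_or_nonpos (hα : IsBaseB α) {β : Lattice r} (hβ : β ∈ rootsB r) :
    (∀ i, 0 ≤ hα.basis.repr β i) ∨ ∀ i, hα.basis.repr β i ≤ 0 := by
  have key : ∀ (c : Fin r → ℕ) i, hα.basis.repr (∑ i, c i • α i) i = c i := fun c i => by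
    have := hα.basis.repr_sum_self (fun i => (c i : ℤ))
    simp only [basis_apply, Nat.cast_smul_eq_nsmul] at this
    exact congrFun this i
  obtain ⟨c, h | h⟩ := hα.pos_or_neg _ hβ
  · left; intro i; rw [h, key]; positivity
  · right; intro i; rw [h, map_neg, Finsupp.neg_apply, key]; simp

/-- The height of a vector relative to a base. -/
def height (hα : IsBaseB α) : Lattice r →ₗ[ℤ] ℤ :=
  ∑ i, hα.basis.coord i

theorem height_apply (hα : IsBaseB α) (v : Lattice r) :
    hα.height v = ∑ i, hα.basis.repr v i := by simp [height]

@[simp] theorem height_self (hα : IsBaseB α) (i : Fin r) : hα.height (α i) = 1 := by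
  simp [height_apply, repr_self]

theorem injective (hα : IsBaseB α) : Function.Injective α := hα.linearIndependent.injective

theorem dotProduct_nonpos (hα : IsBaseB α) {i j : Fin r} (hij : i ≠ j) : α i ⬝ᵥ α j ≤ 0 := by
  by_contra! h
  have h1 := mem_rootsB_iff.mp (hα.mem i)
  have h2 := mem_rootsB_iff.mp (hα.mem j)
  have h3 : (α i - α j) ⬝ᵥ (α i - α j) = α i ⬝ᵥ α i + α j ⬝ᵥ α j - 2 * (α i ⬝ᵥ α j) := by
    simp only [sub_dotProduct, dotProduct_sub, dotProduct_comm (α j) (α i)]; ring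
  have h4 := dotProduct_self_nonneg' (α i - α j)
  have h5 : (α i - α j) ⬝ᵥ (α i - α j) ≠ 0 := by
    rw [Ne, dotProduct_self_eq_zero_iff, sub_eq_zero]
    exact fun h => hij (hα.injective h)
  have h6 : α i - α j ∈ rootsB r := by
    rw [mem_rootsB_iff]
    omega
  rcases hα.repr_nonneg_or_nonpos h6 with h | h
  · have := h j
    simp [repr_self, hij] at this
  · have := h i
    simp [repr_self, hij.symm] at this

theorem sub_notMem_rootsB (hα : IsBaseB α) {i j : Fin r} (hij : i ≠ j) :
    α i - α j ∉ rootsB r := by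
  intro h6
  rcases hα.repr_nonneg_or_nonpos h6 with h | h
  · have := h j
    simp [repr_self, hij] at this
  · have := h i
    simp [repr_self, hij.symm] at this

theorem sub_notMem (hα : IsBaseB α) {i j : Fin r} (hij : i ≠ j) :
    α i - α j ∉ rootsBC r ∪ {0} := by
  rintro (h | h)
  · rcases mem_rootsBC_iff.mp h with h | ⟨w, hw, h⟩
    · exact hα.sub_notMem_rootsB hij h
    · have e := fun k => congrArg (fun v => hα.basis.repr v k) h
      have ei := e i
      have ej := e j
      simp only [map_sub, map_nsmul, Finsupp.sub_apply, repr_self, hij, hij.symm, if_true, if_false,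
        Finsupp.smul_apply] at ei ej
      simp only [nsmul_eq_mul, Nat.cast_ofNat] at ei
      omega
  · exact hij (hα.injective (sub_eq_zero.mp h))

/-- At most one element of a base of `B_r` is short. -/
theorem three_le_norm_add_norm (hα : IsBaseB α) {i j : Fin r} (hij : i ≠ j) :
    3 ≤ α i ⬝ᵥ α i + α j ⬝ᵥ α j := by
  have h1 := mem_rootsB_iff.mp (hα.mem i)
  have h2 := mem_rootsB_iff.mp (hα.mem j)
  by_contra! h
  have h0 := hα.dotProduct_nonpos hij
  have h3 : (α i - α j) ⬝ᵥ (α i - α j) = α i ⬝ᵥ α i + α j ⬝ᵥ α j - 2 * (α i ⬝ᵥ α j) := by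
    simp only [sub_dotProduct, dotProduct_sub, dotProduct_comm (α j) (α i)]; ring
  have h4 : (α i + α j) ⬝ᵥ (α i + α j) = α i ⬝ᵥ α i + α j ⬝ᵥ α j + 2 * (α i ⬝ᵥ α j) := by
    simp only [add_dotProduct, dotProduct_add, dotProduct_comm (α j) (α i)]; ring
  have h5 := dotProduct_self_nonneg' (α i + α j)
  have h6 : (α i + α j) ⬝ᵥ (α i + α j) ≠ 0 := by
    rw [Ne, dotProduct_self_eq_zero_iff]
    intro h
    have := congrArg hα.height h
    simp at this
  apply hα.sub_notMem_rootsB hij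
  rw [mem_rootsB_iff]
  omega

/-- Root induction: a property which is stable under simple reflections and holds for the simple
roots holds for all roots. -/
theorem root_induction (hα : IsBaseB α) {P : Lattice r → Prop} (base : ∀ i, P (α i))
    (step : ∀ i v, P v → P (reflect (α i) v)) {β : Lattice r} (hβ : β ∈ rootsB r) : P β := by
  have main : ∀ (Q : Lattice r → Prop), (∀ i, Q (α i)) → (∀ i v, Q v → Q (reflect (α i) v)) →
      ∀ (n : ℕ) (β : Lattice r), β ∈ rootsB r → (∀ i, 0 ≤ hα.basis.repr β i) →
        hα.height β ≤ n → Q β := by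
    intro Q base step n
    induction n with
    | zero =>
      intro β hβ hpos hn
      exfalso
      rw [height_apply] at hn
      have h0 := (Finset.sum_eq_zero_iff_of_nonneg fun i _ => hpos i).mp
        (le_antisymm (by simpa using hn) (Finset.sum_nonneg fun i _ => hpos i))
      apply ne_zero_of_mem_rootsB hβ
      rw [← hα.sum_repr β]
      exact Finset.sum_eq_zero fun i hi => by rw [h0 i hi, zero_smul]
    | succ n ih =>
      intro β hβ hpos hn
      obtain ⟨i, hi⟩ : ∃ i, 0 < α i ⬝ᵥ β := by
        by_contra! hc
        have : β ⬝ᵥ β ≤ 0 := by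
          nth_rewrite 1 [← hα.sum_repr β]
          rw [sum_dotProduct]
          refine Finset.sum_nonpos fun i _ => ?_
          rw [smul_dotProduct]
          exact mul_nonpos_of_nonneg_of_nonpos (hpos i) (hc i)
        have := dotProduct_self_pos hβ
        omega
      have hm := (corootPairing_pos_iff (hα.mem i)).mpr hi
      by_cases hj : ∃ j, j ≠ i ∧ 0 < hα.basis.repr β j
      · obtain ⟨j, hji, hj⟩ := hj
        rw [← reflect_reflect (hα.mem i) β]
        apply step
        have hr := reflect_mem_rootsB (hα.mem i) hβ
        have hj' : 0 < hα.basis.repr (reflect (α i) β) j := by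
          rwa [reflect, map_sub, map_smul, Finsupp.sub_apply, Finsupp.smul_apply, repr_self,
            if_neg hji.symm, smul_zero, sub_zero]
        refine ih _ hr ((hα.repr_nonneg_or_nonpos hr).resolve_right fun h => ?_) ?_
        · have := h j
          omega
        · simp only [reflect, map_sub, map_smul, height_self, smul_eq_mul, mul_one]
          push_cast at hn
          omega
      · push Not at hj
        have hz : ∀ j, j ≠ i → hα.basis.repr β j = 0 := fun j h => le_antisymm (hj j h) (hpos j)
        have hβi : β = hα.basis.repr β i • α i := by
          conv_lhs => rw [← hα.sum_repr β]
          exact Finset.sum_eq_single i (fun j _ h => by rw [hz j h, zero_smul]) (by simp)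
        set c := hα.basis.repr β i with hc
        have hc0 : 0 ≤ c := hpos i
        have hn : β ⬝ᵥ β = c * c * (α i ⬝ᵥ α i) := by
          rw [hβi, smul_dotProduct, dotProduct_smul, smul_eq_mul, smul_eq_mul]; ring
        have h1 := mem_rootsB_iff.mp hβ
        have h2 := mem_rootsB_iff.mp (hα.mem i)
        have hc1 : c = 1 := by
          have : c < 2 := by
            by_contra! h
            have : 4 ≤ c * c := by nlinarith
            rcases h2 with h2 | h2 <;> rw [h2] at hn <;> omega
          have : c ≠ 0 := by
            intro h
            rw [h] at hn
            omega
          omega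
        rw [hβi, hc1, one_smul]
        exact base i
  have main' := fun Q b s (β : Lattice r) hβ hpos =>
    main Q b s (hα.height β).toNat β hβ hpos (Int.self_le_toNat _)
  rcases hα.repr_nonneg_or_nonpos hβ with h | h
  · exact main' P base step β hβ h
  · rw [← neg_neg β]
    refine main' (fun v => P (-v)) (fun i => ?_) (fun i v hv => ?_) (-β) (neg_mem_rootsB hβ)
      (fun i => by simpa using h i)
    · rw [← reflect_self (hα.mem i)]
      exact step _ _ (base i)
    · rw [← reflect_neg (hα.mem i)]
      exact step _ _ hv

theorem eq_zero_of_forall_dotProduct (hα : IsBaseB α) {v : Lattice r} (h : ∀ i, α i ⬝ᵥ v = 0) :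
    v = 0 := by
  rw [← dotProduct_self_eq_zero_iff]
  nth_rewrite 1 [← hα.sum_repr v]
  rw [sum_dotProduct]
  exact Finset.sum_eq_zero fun i _ => by rw [smul_dotProduct, h i, smul_zero]

/-- The Dynkin diagram of `B_r` is connected. -/
theorem eq_univ_of_closed (hα : IsBaseB α) {J : Set (Fin r)} (hJ : J.Nonempty)
    (hcl : ∀ i ∈ J, ∀ j, α i ⬝ᵥ α j ≠ 0 → j ∈ J) : J = Set.univ := by
  by_contra hne
  obtain ⟨k, hk⟩ := (Set.ne_univ_iff_exists_notMem J).mp hne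
  obtain ⟨l, hl⟩ := hJ
  have hort : ∀ i ∈ J, ∀ j ∉ J, α i ⬝ᵥ α j = 0 := fun i hi j hj => by
    by_contra h
    exact hj (hcl i hi j h)
  have hdich : ∀ β ∈ rootsB r, (∀ j ∈ J, α j ⬝ᵥ β = 0) ∨ ∀ j ∉ J, α j ⬝ᵥ β = 0 := by
    intro β hβ
    refine hα.root_induction (P := fun β => (∀ j ∈ J, α j ⬝ᵥ β = 0) ∨ ∀ j ∉ J, α j ⬝ᵥ β = 0)
      (fun i => ?_) (fun i v hv => ?_) hβ
    · by_cases hi : i ∈ J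
      · exact Or.inr fun j hj => by rw [dotProduct_comm]; exact hort i hi j hj
      · exact Or.inl fun j hj => hort j hj i hi
    · have red : α i ⬝ᵥ v = 0 → reflect (α i) v = v := fun h => by
        rw [reflect, (corootPairing_eq_zero_iff (hα.mem i)).mpr h, zero_smul, sub_zero]
      by_cases hi : i ∈ J
      · rcases hv with hv | hv
        · exact Or.inl fun j hj => by rw [red (hv i hi)]; exact hv j hj
        · refine Or.inr fun j hj => ?_
          rw [reflect, dotProduct_sub, dotProduct_smul, hv j hj, dotProduct_comm, hort i hi j hj]
          simp
      · rcases hv with hv | hv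
        · refine Or.inl fun j hj => ?_
          rw [reflect, dotProduct_sub, dotProduct_smul, hv j hj, hort j hj i hi]
          simp
        · exact Or.inr fun j hj => by rw [red (hv i hi)]; exact hv j hj
  have hnot : ∀ v : Lattice r, v ≠ 0 → (∀ j ∈ J, α j ⬝ᵥ v = 0) → ¬ ∀ j ∉ J, α j ⬝ᵥ v = 0 :=
    fun v hv h1 h2 => hv <| hα.eq_zero_of_forall_dotProduct fun j => by
      by_cases hj : j ∈ J
      exacts [h1 j hj, h2 j hj]
  have hmix : ∀ a b : Fin r, (∀ j ∈ J, α j ⬝ᵥ eps a = 0) → ¬ ∀ j ∉ J, α j ⬝ᵥ eps b = 0 := by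
    intro a b ha hb
    have hab : a ≠ b := by
      rintro rfl
      exact hnot _ (ne_zero_of_mem_rootsB (eps_mem_rootsB a)) ha hb
    rcases hdich (eps a + eps b) (Or.inl ⟨a, b, hab, 1, 1, by simp⟩) with h | h
    · exact hnot _ (ne_zero_of_mem_rootsB (eps_mem_rootsB b))
        (fun j hj => by simpa [dotProduct_add, ha j hj] using h j hj) hb
    · exact hnot _ (ne_zero_of_mem_rootsB (eps_mem_rootsB a)) ha
        (fun j hj => by simpa [dotProduct_add, hb j hj] using h j hj)
  have hzero : ∀ v : Lattice r, (∀ a, v ⬝ᵥ eps a = 0) → v = 0 := fun v h => by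
    ext a
    simpa [dotProduct_eps] using h a
  by_cases hall : ∀ a, ∀ j ∈ J, α j ⬝ᵥ eps a = 0
  · exact ne_zero_of_mem_rootsB (hα.mem l) (hzero _ fun a => hall a l hl)
  · push Not at hall
    obtain ⟨a, j, hj, hja⟩ := hall
    have ha := (hdich _ (eps_mem_rootsB a)).resolve_left fun h => hja (h j hj)
    refine ne_zero_of_mem_rootsB (hα.mem k) (hzero _ fun b => ?_)
    rcases hdich _ (eps_mem_rootsB b) with hb | hb
    · exact absurd ha (hmix b a hb)
    · exact hb k hk

end IsBaseB

/-! ### Weight vectors of `sl₂`-triples -/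

section SlTwo

variable {L : Type*} [LieRing L] [LieAlgebra ℂ L] {e f h : L}

theorem lie_pow_ad_of_weight (hf : ⁅h, f⁆ = (-2 : ℂ) • f) {x : L} {μ : ℂ}
    (hx : ⁅h, x⁆ = μ • x) (k : ℕ) :
    ⁅h, (LieAlgebra.ad ℂ L f ^ k) x⁆ = (μ - 2 * k) • (LieAlgebra.ad ℂ L f ^ k) x := by
  induction k with
  | zero => simpa using hx
  | succ k ih =>
    rw [pow_succ', Module.End.mul_apply, LieAlgebra.ad_apply, leibniz_lie, hf, ih]
    simp only [smul_lie, lie_smul, ← add_smul]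
    congr 1
    push_cast
    ring

theorem lie_pow_succ_ad_of_weight (hef : ⁅e, f⁆ = h) (hf : ⁅h, f⁆ = (-2 : ℂ) • f) {x : L} {μ : ℂ}
    (hx : ⁅h, x⁆ = μ • x) (k : ℕ) :
    ⁅e, (LieAlgebra.ad ℂ L f ^ (k + 1)) x⁆ = (LieAlgebra.ad ℂ L f ^ (k + 1)) ⁅e, x⁆ +
      ((k + 1) * (μ - k)) • (LieAlgebra.ad ℂ L f ^ k) x := by
  induction k with
  | zero =>
    simp only [zero_add, pow_one, pow_zero, LieAlgebra.ad_apply, Module.End.one_apply]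
    rw [leibniz_lie, hef, hx]
    simp [add_comm]
  | succ k ih =>
    rw [pow_succ', Module.End.mul_apply, LieAlgebra.ad_apply, leibniz_lie, hef, ih,
      lie_pow_ad_of_weight hf hx, lie_add, lie_smul, Module.End.mul_apply,
      LieAlgebra.ad_apply, ← LieAlgebra.ad_apply ℂ L f ((LieAlgebra.ad ℂ L f ^ k) x),
      ← Module.End.mul_apply (LieAlgebra.ad ℂ L f) (LieAlgebra.ad ℂ L f ^ k), ← pow_succ',
      add_left_comm, ← add_smul]
    congr 2
    push_cast
    ring

/-- On a locally nilpotent vector of weight `m ≥ 0` the operator `(ad f) ^ m` is injective. -/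
theorem eq_zero_of_pow_ad_eq_zero (hef : ⁅e, f⁆ = h) (he : ⁅h, e⁆ = (2 : ℂ) • e)
    (hf : ⁅h, f⁆ = (-2 : ℂ) • f) (N : ℕ) :
    ∀ (m : ℕ) (x : L), ⁅h, x⁆ = (m : ℂ) • x → (LieAlgebra.ad ℂ L e ^ N) x = 0 →
      (LieAlgebra.ad ℂ L f ^ m) x = 0 → x = 0 := by
  induction N with
  | zero => intro m x _ hx _; simpa using hx
  | succ N ih =>
    intro m x hx hN hm
    have hex : ⁅e, x⁆ = 0 := by
      refine ih (m + 2) ⁅e, x⁆ ?_ ?_ ?_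
      · rw [leibniz_lie, he, hx, smul_lie, lie_smul, ← add_smul]
        congr 1
        push_cast
        ring
      · rwa [pow_succ, Module.End.mul_apply, LieAlgebra.ad_apply] at hN
      · have h1 := lie_pow_succ_ad_of_weight hef hf hx (m + 1)
        rw [pow_succ' _ (m + 1), pow_succ' _ m] at h1
        simp only [Module.End.mul_apply, hm, map_zero, lie_zero, smul_zero, add_zero] at h1
        rw [pow_succ', pow_succ']
        exact h1.symm
    have hdown : ∀ j ≤ m, (LieAlgebra.ad ℂ L f ^ (m - j)) x = 0 := by
      intro j
      induction j with
      | zero => intro _; simpa using hm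
      | succ j ihj =>
        intro hj
        have h1 := lie_pow_succ_ad_of_weight hef hf hx (m - (j + 1))
        have hk : m - (j + 1) + 1 = m - j := by omega
        rw [hk, ihj (by omega), hex, lie_zero, map_zero, zero_add] at h1
        refine (smul_eq_zero.mp h1.symm).resolve_left (mul_ne_zero (Nat.cast_add_one_ne_zero _) ?_)
        rw [Nat.cast_sub hj]
        push_cast
        rw [sub_sub_cancel]
        exact Nat.cast_add_one_ne_zero _
    simpa using hdown m le_rfl

end SlTwo

/-! ### Families of subspaces compatible with the bracket -/

section Families

variable {L : Type*} [LieRing L] [LieAlgebra ℂ L] {Γ : Type*}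

/-- The sum of a family of subspaces `V γ` with `[V γ, V δ] ⊆ V (γ + δ)`, as a subalgebra. -/
def iSupSubalgebra [Add Γ] (V : Γ → Submodule ℂ L)
    (hV : ∀ γ δ, ∀ x ∈ V γ, ∀ y ∈ V δ, ⁅x, y⁆ ∈ V (γ + δ)) : LieSubalgebra ℂ L where
  __ := ⨆ γ, V γ
  lie_mem' {x y} hx hy := by
    change x ∈ ⨆ γ, V γ at hx
    change y ∈ ⨆ γ, V γ at hy
    change ⁅x, y⁆ ∈ ⨆ γ, V γ
    induction hx using Submodule.iSup_induction' with
    | zero => simp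
    | add a b _ _ ha hb => rw [add_lie]; exact add_mem ha hb
    | mem γ a ha =>
      induction hy using Submodule.iSup_induction' with
      | zero => simp
      | add b c _ _ hb hc => rw [lie_add]; exact add_mem hb hc
      | mem δ b hb => exact Submodule.mem_iSup_of_mem _ (hV γ δ a ha b hb)

theorem lieSpan_le_iSup [Add Γ] {V : Γ → Submodule ℂ L}
    (hV : ∀ γ δ, ∀ x ∈ V γ, ∀ y ∈ V δ, ⁅x, y⁆ ∈ V (γ + δ)) {s : Set L}
    (hs : ∀ x ∈ s, ∃ γ, x ∈ V γ) {x : L} (hx : x ∈ LieSubalgebra.lieSpan ℂ L s) :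
    x ∈ ⨆ γ, V γ := by
  have : LieSubalgebra.lieSpan ℂ L s ≤ iSupSubalgebra V hV :=
    LieSubalgebra.lieSpan_le.mpr fun y hy => by
      obtain ⟨γ, h⟩ := hs y hy
      exact Submodule.mem_iSup_of_mem (p := V) γ h
  exact this hx

/-- The projection to a summand of an internal direct sum. -/
def gradedProj (G : Γ → Submodule ℂ L) [DecidableEq Γ] 
    (hG : Function.Bijective (DirectSum.coeLinearMap G)) (γ : Γ) :
    L →ₗ[ℂ] L :=
  (G γ).subtype ∘ₗ DirectSum.component ℂ Γ (fun γ => G γ) γ ∘ₗ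
    (LinearEquiv.ofBijective (DirectSum.coeLinearMap G) hG).symm.toLinearMap

variable {G : Γ → Submodule ℂ L} [DecidableEq Γ]

theorem gradedProj_of_mem (hG : Function.Bijective (DirectSum.coeLinearMap G))
    {γ : Γ} {x : L} (hx : x ∈ G γ) : gradedProj G hG γ x = x := by
  have : (LinearEquiv.ofBijective (DirectSum.coeLinearMap G) hG).symm x =
      DirectSum.lof ℂ Γ (fun γ => G γ) γ ⟨x, hx⟩ := by
    rw [LinearEquiv.symm_apply_eq]
    simp [DirectSum.coeLinearMap_lof]
  simp [gradedProj, this, DirectSum.component.lof_self]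

theorem gradedProj_of_mem_of_ne (hG : Function.Bijective (DirectSum.coeLinearMap G))
    {γ δ : Γ} {x : L} (hx : x ∈ G δ) (h : δ ≠ γ) :
    gradedProj G hG γ x = 0 := by
  have : (LinearEquiv.ofBijective (DirectSum.coeLinearMap G) hG).symm x =
      DirectSum.lof ℂ Γ (fun γ => G γ) δ ⟨x, hx⟩ := by
    rw [LinearEquiv.symm_apply_eq]
    simp [DirectSum.coeLinearMap_lof]
  simp [gradedProj, this, DirectSum.component.of, h]

/-- A homogeneous element in the span of homogeneous elements lies in the span of those which have
the right degree. -/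
theorem mem_of_mem_span_homogeneous (hG : Function.Bijective (DirectSum.coeLinearMap G))
    {s : Set L} {γ : Γ} {T : Submodule ℂ L}
    (hs : ∀ y ∈ s, ∃ δ, y ∈ G δ ∧ (δ = γ → y ∈ T)) {x : L} (hx : x ∈ Submodule.span ℂ s)
    (hxγ : x ∈ G γ) : x ∈ T := by
  rw [← gradedProj_of_mem hG hxγ]
  have : Submodule.span ℂ s ≤ T.comap (gradedProj G hG γ) := Submodule.span_le.mpr fun y hy => by
    obtain ⟨δ, hδ, hT⟩ := hs y hy
    by_cases h : δ = γ
    · subst h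
      simpa [gradedProj_of_mem hG hδ] using hT rfl
    · simp [gradedProj_of_mem_of_ne hG hδ h]
  exact this hx

theorem mem_of_mem_iSup (hG : Function.Bijective (DirectSum.coeLinearMap G))
    {V : Γ → Submodule ℂ L} (hV : ∀ γ, V γ ≤ G γ) {γ : Γ} {x : L}
    (hx : x ∈ ⨆ γ, V γ) (hxγ : x ∈ G γ) : x ∈ V γ := by
  rw [Submodule.iSup_eq_span] at hx
  refine mem_of_mem_span_homogeneous hG (fun y hy => ?_) hx hxγ
  obtain ⟨δ, hδ⟩ := Set.mem_iUnion.mp hy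
  exact ⟨δ, hV δ hδ, fun h => h ▸ hδ⟩

end Families

/-! ### Lie algebras graded by the lattice and supported on `BC_r` -/

/-- A Lie algebra with a grading by the lattice which is supported on `Δ ∪ {0}`, generated by
its components of nonzero degree, and with an `sl₂`-triple for each of the roots `α i`. -/
structure TripleGrading {r : ℕ} (α : Fin r → Lattice r) (L : Type*) [LieRing L]
    [LieAlgebra ℂ L] where
  /-- The homogeneous components. -/
  G : Lattice r → Submodule ℂ L
  /-- The raising elements. -/
  e : Fin r → L
  /-- The lowering elements. -/
  f : Fin r → L
  /-- The coroots. -/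
  h : Fin r → L
  e_mem : ∀ i, e i ∈ G (α i)
  f_mem : ∀ i, f i ∈ G (-α i)
  lie_mem : ∀ γ δ, ∀ x ∈ G γ, ∀ y ∈ G δ, ⁅x, y⁆ ∈ G (γ + δ)
  eq_bot : ∀ γ, γ ∉ rootsBC r ∪ {0} → G γ = ⊥
  lie_e_f : ∀ i, ⁅e i, f i⁆ = h i
  lie_h : ∀ i γ, ∀ x ∈ G γ, ⁅h i, x⁆ = (corootPairing (α i) γ : ℂ) • x
  lieSpan_eq_top : LieSubalgebra.lieSpan ℂ L {x | ∃ γ ∈ rootsBC r, x ∈ G γ} = ⊤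
  e_ne_zero : ∀ i, e i ≠ 0

namespace TripleGrading

variable {r : ℕ} {α : Fin r → Lattice r} {L : Type*} [LieRing L] [LieAlgebra ℂ L]

theorem h_mem (D : TripleGrading α L) (i : Fin r) : D.h i ∈ D.G 0 := by
  rw [← D.lie_e_f, ← add_neg_cancel (α i)]
  exact D.lie_mem _ _ _ (D.e_mem i) _ (D.f_mem i)

theorem mem_support (D : TripleGrading α L) {γ : Lattice r} {x : L} (hx : x ∈ D.G γ)
    (h0 : x ≠ 0) : γ ∈ rootsBC r ∪ {0} := by
  by_contra h
  rw [D.eq_bot γ h] at hx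
  exact h0 hx

theorem iSup_eq_top (D : TripleGrading α L) : ⨆ γ, D.G γ = ⊤ := by
  refine eq_top_iff.mpr fun x _ => lieSpan_le_iSup D.lie_mem
    (s := {x | ∃ γ ∈ rootsBC r, x ∈ D.G γ}) (fun y ⟨γ, _, hy⟩ => ⟨γ, hy⟩) ?_
  rw [D.lieSpan_eq_top]
  trivial

theorem exists_corootPairing_ne (hα : IsBaseB α) {γ δ : Lattice r} (h : γ ≠ δ) :
    ∃ j, corootPairing (α j) γ ≠ corootPairing (α j) δ := by
  by_contra! hc
  refine h (sub_eq_zero.mp (hα.eq_zero_of_forall_dotProduct fun i => ?_))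
  rw [← corootPairing_eq_zero_iff (hα.mem i), sub_eq_add_neg, corootPairing_add (hα.mem i),
    corootPairing_neg (hα.mem i), hc i, add_neg_cancel]

/-- A subspace stable under the coroots contains the homogeneous components of its elements. -/
theorem component_mem (D : TripleGrading α L) (hα : IsBaseB α) {U : Submodule ℂ L}
    (hU : ∀ i, ∀ x ∈ U, ⁅D.h i, x⁆ ∈ U) (s : Finset (Lattice r)) :
    ∀ x : Lattice r → L, (∀ γ, x γ ∈ D.G γ) → ∑ γ ∈ s, x γ ∈ U → ∀ γ ∈ s, x γ ∈ U := by
  classical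
  induction s using Finset.induction_on with
  | empty => simp
  | insert δ s hδ ih =>
    intro x hx hsum
    have hs : ∀ γ ∈ s, x γ ∈ U := by
      intro γ hγ
      obtain ⟨j, hj⟩ := exists_corootPairing_ne hα (show γ ≠ δ by rintro rfl; exact hδ hγ)
      have h1 : ∑ γ ∈ s, ((corootPairing (α j) γ - corootPairing (α j) δ : ℤ) : ℂ) • x γ ∈ U := by
        have h2 := sub_mem (hU j _ hsum)
          (U.smul_mem ((corootPairing (α j) δ : ℤ) : ℂ) hsum)
        rw [lie_sum, Finset.smul_sum, ← Finset.sum_sub_distrib, Finset.sum_insert hδ,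
          D.lie_h j _ _ (hx δ), sub_self, zero_add] at h2
        convert h2 using 2 with γ
        rw [D.lie_h j _ _ (hx γ), ← sub_smul]
        push_cast
        rfl
      have h2 := ih (fun γ => ((corootPairing (α j) γ - corootPairing (α j) δ : ℤ) : ℂ) • x γ)
        (fun γ => (D.G γ).smul_mem _ (hx γ)) h1 γ hγ
      exact (U.smul_mem_iff (by exact_mod_cast sub_ne_zero.mpr hj)).mp h2
    intro γ hγ
    rcases Finset.mem_insert.mp hγ with rfl | hγ
    · rw [Finset.sum_insert hδ] at hsum
      exact (Submodule.add_mem_iff_left U (U.sum_mem hs)).mp hsum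
    · exact hs γ hγ

theorem exists_components (D : TripleGrading α L) (x : L) :
    ∃ (s : Finset (Lattice r)) (y : Lattice r → L), (∀ γ, y γ ∈ D.G γ) ∧ ∑ γ ∈ s, y γ = x := by
  obtain ⟨f, hf, hx⟩ := (Submodule.mem_iSup_iff_exists_finsupp D.G x).mp
    (D.iSup_eq_top ▸ Submodule.mem_top)
  exact ⟨f.support, f, hf, hx⟩

theorem isInternal (D : TripleGrading α L) (hα : IsBaseB α) : DirectSum.IsInternal D.G := by
  classical
  refine DirectSum.isInternal_submodule_of_iSupIndep_of_iSup_eq_top ?_ D.iSup_eq_top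
  rw [iSupIndep_iff_finsetSum_eq_zero_imp_eq_zero]
  intro s x hx hsum γ hγ
  have h0 : ∀ γ, (if γ ∈ s then x γ else 0) ∈ D.G γ := fun γ => by
    split_ifs with h
    exacts [hx γ h, zero_mem _]
  have h1 := D.component_mem hα (U := ⊥)
    (fun i x hx => by rw [(Submodule.mem_bot ℂ).mp hx, lie_zero]; exact zero_mem _) s _ h0
    (by rw [Finset.sum_congr rfl fun γ hγ => if_pos hγ, hsum]; exact zero_mem _) γ hγ
  simpa [hγ] using h1

/-- A common eigenvector of the coroots is homogeneous. -/
theorem exists_mem_of_eigenvector (D : TripleGrading α L) (hα : IsBaseB α) {x : L} (hx0 : x ≠ 0)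
    {φ : Fin r → ℂ} (hx : ∀ i, ⁅D.h i, x⁆ = φ i • x) :
    ∃ γ, x ∈ D.G γ ∧ ∀ i, φ i = corootPairing (α i) γ := by
  obtain ⟨s, y, hy, rfl⟩ := D.exists_components x
  have key : ∀ i, ∀ γ ∈ s, ((corootPairing (α i) γ : ℂ) - φ i) • y γ = 0 := fun i => by
    refine fun γ hγ => (Submodule.mem_bot ℂ).mp <| D.component_mem hα (U := ⊥)
      (fun i x hx => by rw [(Submodule.mem_bot ℂ).mp hx, lie_zero]; exact zero_mem _) s
      (fun γ => ((corootPairing (α i) γ : ℂ) - φ i) • y γ)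
      (fun γ => (D.G γ).smul_mem _ (hy γ)) ?_ γ hγ
    rw [Submodule.mem_bot]
    simp only [sub_smul, Finset.sum_sub_distrib]
    rw [← Finset.smul_sum, ← hx i, lie_sum, sub_eq_zero]
    exact Finset.sum_congr rfl fun γ _ => (D.lie_h i _ _ (hy γ)).symm
  obtain ⟨γ, hγ, hγ0⟩ := Finset.exists_ne_zero_of_sum_ne_zero hx0
  have hφ : ∀ i, φ i = corootPairing (α i) γ := fun i =>
    (sub_eq_zero.mp ((smul_eq_zero.mp (key i γ hγ)).resolve_right hγ0)).symm
  refine ⟨γ, ?_, hφ⟩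
  rw [Finset.sum_eq_single γ (fun δ hδ hne => ?_) (fun h => absurd hγ h)]
  · exact hy γ
  · obtain ⟨j, hj⟩ := exists_corootPairing_ne hα hne
    refine (smul_eq_zero.mp (key j δ hδ)).resolve_left ?_
    rw [hφ j]
    exact sub_ne_zero.mpr (by exact_mod_cast hj)

theorem f_ne_zero (D : TripleGrading α L) (hα : ∀ i, α i ∈ rootsB r) (i : Fin r) : D.f i ≠ 0 := by
  intro hf
  have h1 := D.lie_h i _ _ (D.e_mem i)
  rw [← D.lie_e_f i, hf, lie_zero, zero_lie, corootPairing_self (hα i)] at h1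
  exact D.e_ne_zero i ((smul_eq_zero.mp h1.symm).resolve_left (by norm_num))

/-- The same grading with the roles of the raising and lowering elements interchanged. -/
def symm (D : TripleGrading α L) (hα : ∀ i, α i ∈ rootsB r) :
    TripleGrading (fun i => -α i) L where
  G := D.G
  e := D.f
  f := D.e
  h i := -D.h i
  e_mem := D.f_mem
  f_mem i := by rw [neg_neg]; exact D.e_mem i
  lie_mem := D.lie_mem
  eq_bot := D.eq_bot
  lie_e_f i := by rw [← lie_skew, D.lie_e_f]
  lie_h i γ x hx := by
    rw [neg_lie, D.lie_h i γ x hx, corootPairing_neg_left (hα i)]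
    simp
  lieSpan_eq_top := D.lieSpan_eq_top
  e_ne_zero := D.f_ne_zero hα

end TripleGrading

namespace TripleGrading

variable {r : ℕ} {α : Fin r → Lattice r} {L : Type*} [LieRing L] [LieAlgebra ℂ L]

/-! ### Reflections and weight spaces -/

theorem pow_ad_mem (D : TripleGrading α L) {γ δ : Lattice r} {x y : L} (hy : y ∈ D.G δ)
    (hx : x ∈ D.G γ) (k : ℕ) : (LieAlgebra.ad ℂ L y ^ k) x ∈ D.G (γ + k • δ) := by
  induction k with
  | zero => simpa using hx
  | succ k ih =>
    rw [pow_succ', Module.End.mul_apply, LieAlgebra.ad_apply]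
    convert D.lie_mem _ _ _ hy _ ih using 2
    rw [succ_nsmul]
    abel

theorem pow_ad_eq_zero (D : TripleGrading α L) {γ δ : Lattice r} {x y : L} (hδ : δ ≠ 0)
    (hy : y ∈ D.G δ) (hx : x ∈ D.G γ) : (LieAlgebra.ad ℂ L y ^ 5) x = 0 := by
  by_cases hx0 : x = 0
  · rw [hx0, map_zero]
  by_contra h
  have bound : ∀ v ∈ rootsBC r ∪ {0}, v ⬝ᵥ v ≤ 4 := by
    rintro v (hv | rfl)
    · exact dotProduct_self_le_of_mem_rootsBC hv
    · simp
  have h1 := bound _ (D.mem_support hx hx0)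
  have h2 := bound _ (D.mem_support (D.pow_ad_mem hy hx 5) h)
  obtain ⟨i, hi⟩ := Function.ne_iff.mp hδ
  simp only [Pi.zero_apply] at hi
  have h3 := (sq_apply_le_dotProduct_self _ i).trans h1
  have h4 := (sq_apply_le_dotProduct_self _ i).trans h2
  rw [Pi.add_apply, Pi.smul_apply, nsmul_eq_mul, Nat.cast_ofNat] at h4
  have h5 : -3 < γ i := by nlinarith
  have h6 : γ i < 3 := by nlinarith
  have h7 : -3 < γ i + 5 * δ i := by nlinarith
  have h8 : γ i + 5 * δ i < 3 := by nlinarith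
  omega

/-- A subspace which is stable under the raising and lowering elements. -/
def Stable (D : TripleGrading α L) (U : Submodule ℂ L) : Prop :=
  ∀ i, ∀ x ∈ U, ⁅D.e i, x⁆ ∈ U ∧ ⁅D.f i, x⁆ ∈ U

theorem Stable.lie_h_mem {D : TripleGrading α L} {U : Submodule ℂ L} (hU : D.Stable U) (i : Fin r)
    {x : L} (hx : x ∈ U) : ⁅D.h i, x⁆ ∈ U := by
  rw [← D.lie_e_f, lie_lie]
  exact sub_mem (hU i _ (hU i _ hx).2).1 (hU i _ (hU i _ hx).1).2

theorem exists_string_of_nonneg (D : TripleGrading α L) (hα : ∀ i, α i ∈ rootsB r) (i : Fin r)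
    (γ : Lattice r) (hγ : 0 ≤ corootPairing (α i) γ) :
    ∃ φ : L →ₗ[ℂ] L, ∀ x ∈ D.G γ, φ x ∈ D.G (reflect (α i) γ) ∧ (φ x = 0 → x = 0) ∧
      ∀ U, D.Stable U → x ∈ U → φ x ∈ U := by
  obtain ⟨m, hm⟩ := Int.eq_ofNat_of_zero_le hγ
  refine ⟨LieAlgebra.ad ℂ L (D.f i) ^ m, fun x hx => ⟨?_, fun h => ?_, fun U hU hxU => ?_⟩⟩
  · convert D.pow_ad_mem (D.f_mem i) hx m using 2
    rw [reflect, hm]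
    simp [sub_eq_add_neg]
  · refine eq_zero_of_pow_ad_eq_zero (D.lie_e_f i) (h := D.h i) ?_ ?_ 5 m x ?_
      (D.pow_ad_eq_zero (ne_zero_of_mem_rootsB (hα i)) (D.e_mem i) hx) h
    · rw [D.lie_h i _ _ (D.e_mem i), corootPairing_self (hα i)]
      norm_num
    · rw [D.lie_h i _ _ (D.f_mem i), corootPairing_neg (hα i), corootPairing_self (hα i)]
      norm_num
    · rw [D.lie_h i _ _ hx, hm]
      norm_cast
  · clear hm
    induction m with
    | zero => simpa using hxU
    | succ m ih =>
      rw [pow_succ', Module.End.mul_apply, LieAlgebra.ad_apply]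
      exact (hU i _ ih).2

/-- Every simple reflection is realized by injective maps between homogeneous components, which
preserve all stable subspaces. -/
theorem exists_string (D : TripleGrading α L) (hα : ∀ i, α i ∈ rootsB r) (i : Fin r)
    (γ : Lattice r) :
    ∃ φ : L →ₗ[ℂ] L, ∀ x ∈ D.G γ, φ x ∈ D.G (reflect (α i) γ) ∧ (φ x = 0 → x = 0) ∧
      ∀ U, D.Stable U → x ∈ U → φ x ∈ U := by
  rcases le_total 0 (corootPairing (α i) γ) with h | h
  · exact D.exists_string_of_nonneg hα i γ h
  · obtain ⟨φ, hφ⟩ := (D.symm hα).exists_string_of_nonneg (fun i => neg_mem_rootsB (hα i)) i γ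
      (by rw [corootPairing_neg_left (hα i)]; omega)
    refine ⟨φ, fun x hx => ⟨?_, (hφ x hx).2.1, fun U hU => (hφ x hx).2.2 U fun i x hx =>
      ⟨(hU i x hx).2, (hU i x hx).1⟩⟩⟩
    have h1 := (hφ x hx).1
    have h2 : reflect (-α i) γ = reflect (α i) γ := by
      simp [reflect, corootPairing_neg_left (hα i)]
    change φ x ∈ D.G (reflect (-α i) γ) at h1
    rwa [h2] at h1

theorem inf_eq_bot_of_reflect (D : TripleGrading α L) (hα : ∀ i, α i ∈ rootsB r)
    {U : Submodule ℂ L} (hU : D.Stable U) (i : Fin r) {γ : Lattice r} (h : U ⊓ D.G γ = ⊥) :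
    U ⊓ D.G (reflect (α i) γ) = ⊥ := by
  obtain ⟨φ, hφ⟩ := D.exists_string hα i (reflect (α i) γ)
  refine (Submodule.eq_bot_iff _).mpr fun x ⟨hxU, hx⟩ => (hφ x hx).2.1 ?_
  have h1 := (hφ x hx).1
  rw [reflect_reflect (hα i)] at h1
  exact (Submodule.eq_bot_iff _).mp h _ ⟨(hφ x hx).2.2 U hU hxU, h1⟩

theorem finite_inf_of_reflect (D : TripleGrading α L) (hα : ∀ i, α i ∈ rootsB r)
    {U : Submodule ℂ L} (hU : D.Stable U) (i : Fin r) {γ : Lattice r}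
    (h : Module.Finite ℂ ↥(U ⊓ D.G γ)) : Module.Finite ℂ ↥(U ⊓ D.G (reflect (α i) γ)) := by
  obtain ⟨φ, hφ⟩ := D.exists_string hα i (reflect (α i) γ)
  have hmap : ∀ x ∈ U ⊓ D.G (reflect (α i) γ), φ x ∈ U ⊓ D.G γ := fun x ⟨hxU, hx⟩ => by
    have h1 := (hφ x hx).1
    rw [reflect_reflect (hα i)] at h1
    exact ⟨(hφ x hx).2.2 U hU hxU, h1⟩
  refine FiniteDimensional.of_injective (φ.restrict hmap) ?_
  rw [injective_iff_map_eq_zero]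
  rintro ⟨x, hx⟩ h0
  exact Subtype.ext ((hφ x hx.2).2.1 (congrArg Subtype.val h0))

/-! ### The grading subalgebra -/

/-- The subalgebra generated by the raising and lowering elements. -/
def subalgebra (D : TripleGrading α L) : LieSubalgebra ℂ L :=
  LieSubalgebra.lieSpan ℂ L (Set.range D.e ∪ Set.range D.f)

theorem e_mem_subalgebra (D : TripleGrading α L) (i : Fin r) : D.e i ∈ D.subalgebra :=
  LieSubalgebra.subset_lieSpan (Or.inl ⟨i, rfl⟩)

theorem f_mem_subalgebra (D : TripleGrading α L) (i : Fin r) : D.f i ∈ D.subalgebra :=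
  LieSubalgebra.subset_lieSpan (Or.inr ⟨i, rfl⟩)

theorem h_mem_subalgebra (D : TripleGrading α L) (i : Fin r) : D.h i ∈ D.subalgebra := by
  rw [← D.lie_e_f]
  exact D.subalgebra.lie_mem (D.e_mem_subalgebra i) (D.f_mem_subalgebra i)

theorem stable_subalgebra (D : TripleGrading α L) : D.Stable D.subalgebra.toSubmodule :=
  fun i _ hx => ⟨D.subalgebra.lie_mem (D.e_mem_subalgebra i) hx,
    D.subalgebra.lie_mem (D.f_mem_subalgebra i) hx⟩

/-- Iterated brackets of raising elements. -/
def word (D : TripleGrading α L) (i : Fin r) (l : List (Fin r)) : L :=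
  l.foldr (fun j x => ⁅D.e j, x⁆) (D.e i)

theorem word_mem (D : TripleGrading α L) (i : Fin r) (l : List (Fin r)) :
    D.word i l ∈ D.G ((l.map α).sum + α i) := by
  induction l with
  | nil => simpa [word] using D.e_mem i
  | cons j l ih =>
    rw [List.map_cons, List.sum_cons, add_assoc]
    exact D.lie_mem _ _ _ (D.e_mem j) _ ih

/-- The span of the coroots and the iterated brackets of raising elements. -/
def borel (D : TripleGrading α L) : Submodule ℂ L :=
  Submodule.span ℂ (Set.range D.h ∪ Set.range fun p : Fin r × List (Fin r) => D.word p.1 p.2)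

theorem h_mem_borel (D : TripleGrading α L) (i : Fin r) : D.h i ∈ D.borel :=
  Submodule.subset_span (Or.inl ⟨i, rfl⟩)

theorem word_mem_borel (D : TripleGrading α L) (i : Fin r) (l : List (Fin r)) :
    D.word i l ∈ D.borel :=
  Submodule.subset_span (Or.inr ⟨(i, l), rfl⟩)

theorem e_lie_mem_borel (D : TripleGrading α L) (i : Fin r) {x : L} (hx : x ∈ D.borel) :
    ⁅D.e i, x⁆ ∈ D.borel := by
  have : D.borel ≤ D.borel.comap (LieAlgebra.ad ℂ L (D.e i) : L →ₗ[ℂ] L) := by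
    refine Submodule.span_le.mpr ?_
    rintro _ (⟨j, rfl⟩ | ⟨⟨j, l⟩, rfl⟩)
    · change ⁅D.e i, D.h j⁆ ∈ D.borel
      rw [← lie_skew, D.lie_h j _ _ (D.e_mem i)]
      exact neg_mem (Submodule.smul_mem _ _ (D.word_mem_borel i []))
    · exact D.word_mem_borel j (i :: l)
  exact this hx

theorem lie_e_f_of_ne (D : TripleGrading α L)
    (hsub : ∀ i j, i ≠ j → α i - α j ∉ rootsBC r ∪ {0}) {i j : Fin r} (hij : i ≠ j) :
    ⁅D.e i, D.f j⁆ = 0 := by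
  have := D.lie_mem _ _ _ (D.e_mem i) _ (D.f_mem j)
  rwa [← sub_eq_add_neg, D.eq_bot _ (hsub i j hij), Submodule.mem_bot] at this

theorem f_lie_word_mem (D : TripleGrading α L)
    (hsub : ∀ i j, i ≠ j → α i - α j ∉ rootsBC r ∪ {0}) (i j : Fin r) (l : List (Fin r)) :
    ⁅D.f i, D.word j l⁆ ∈ D.borel := by
  induction l with
  | nil =>
    change ⁅D.f i, D.e j⁆ ∈ D.borel
    rw [← lie_skew]
    by_cases hij : j = i
    · subst hij
      rw [D.lie_e_f]
      exact neg_mem (D.h_mem_borel j)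
    · rw [D.lie_e_f_of_ne hsub hij, neg_zero]
      exact zero_mem _
  | cons k l ih =>
    change ⁅D.f i, ⁅D.e k, D.word j l⁆⁆ ∈ D.borel
    rw [leibniz_lie, ← lie_skew (D.f i)]
    refine add_mem ?_ (D.e_lie_mem_borel k ih)
    by_cases hik : k = i
    · subst hik
      rw [D.lie_e_f, neg_lie, D.lie_h k _ _ (D.word_mem j l)]
      exact neg_mem (Submodule.smul_mem _ _ (D.word_mem_borel j l))
    · rw [D.lie_e_f_of_ne hsub hik, neg_zero, zero_lie]
      exact zero_mem _

theorem f_lie_mem (D : TripleGrading α L)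
    (hsub : ∀ i j, i ≠ j → α i - α j ∉ rootsBC r ∪ {0}) (i : Fin r) {x : L} (hx : x ∈ D.borel) :
    ⁅D.f i, x⁆ ∈ D.borel ⊔ Submodule.span ℂ (Set.range D.f) := by
  have : D.borel ≤ (D.borel ⊔ Submodule.span ℂ (Set.range D.f)).comap
      (LieAlgebra.ad ℂ L (D.f i) : L →ₗ[ℂ] L) := by
    refine Submodule.span_le.mpr ?_
    rintro _ (⟨j, rfl⟩ | ⟨⟨j, l⟩, rfl⟩)
    · refine Submodule.mem_sup_right ?_
      change ⁅D.f i, D.h j⁆ ∈ _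
      rw [← lie_skew, D.lie_h j _ _ (D.f_mem i)]
      exact neg_mem (Submodule.smul_mem _ _ (Submodule.subset_span ⟨i, rfl⟩))
    · exact Submodule.mem_sup_left (D.f_lie_word_mem hsub i j l)
  exact this hx

theorem span_f_le (D : TripleGrading α L) (hα : ∀ i, α i ∈ rootsB r) :
    Submodule.span ℂ (Set.range D.f) ≤ (D.symm hα).borel := by
  refine Submodule.span_le.mpr ?_
  rintro _ ⟨i, rfl⟩
  exact (D.symm hα).word_mem_borel i []

theorem span_e_le (D : TripleGrading α L) : Submodule.span ℂ (Set.range D.e) ≤ D.borel := by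
  refine Submodule.span_le.mpr ?_
  rintro _ ⟨i, rfl⟩
  exact D.word_mem_borel i []

/-- The triangular decomposition. -/
theorem subalgebra_le_sup (D : TripleGrading α L) (hα : IsBaseB α) :
    D.subalgebra.toSubmodule ≤ D.borel ⊔ (D.symm hα.mem).borel := by
  set S := D.borel ⊔ (D.symm hα.mem).borel with hS
  have hsub : ∀ i j, i ≠ j → α i - α j ∉ rootsBC r ∪ {0} := fun i j => hα.sub_notMem
  have hsub' : ∀ i j, i ≠ j → -α i - -α j ∉ rootsBC r ∪ {0} := fun i j hij => by
    rw [neg_sub_neg]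
    exact hα.sub_notMem hij.symm
  have he : ∀ i, ∀ x ∈ S, ⁅D.e i, x⁆ ∈ S := by
    intro i x hx
    obtain ⟨y, hy, z, hz, rfl⟩ := Submodule.mem_sup.mp hx
    rw [lie_add]
    refine add_mem (Submodule.mem_sup_left (D.e_lie_mem_borel i hy)) ?_
    have h1 : (D.symm hα.mem).borel ⊔ Submodule.span ℂ (Set.range D.e) ≤ S :=
      sup_le le_sup_right (D.span_e_le.trans le_sup_left)
    exact h1 ((D.symm hα.mem).f_lie_mem hsub' i hz)
  have hf : ∀ i, ∀ x ∈ S, ⁅D.f i, x⁆ ∈ S := by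
    intro i x hx
    obtain ⟨y, hy, z, hz, rfl⟩ := Submodule.mem_sup.mp hx
    rw [lie_add]
    refine add_mem ?_ (Submodule.mem_sup_right ((D.symm hα.mem).e_lie_mem_borel i hz))
    have h1 : D.borel ⊔ Submodule.span ℂ (Set.range D.f) ≤ S :=
      sup_le le_sup_left ((D.span_f_le hα.mem).trans le_sup_right)
    exact h1 (D.f_lie_mem hsub i hy)
  have key : ∀ x ∈ D.subalgebra, x ∈ S ∧ ∀ y ∈ S, ⁅x, y⁆ ∈ S := by
    intro x hx
    induction hx using LieSubalgebra.lieSpan_induction with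
    | mem x hx =>
      rcases hx with ⟨i, rfl⟩ | ⟨i, rfl⟩
      · exact ⟨Submodule.mem_sup_left (D.word_mem_borel i []), he i⟩
      · exact ⟨Submodule.mem_sup_right ((D.symm hα.mem).word_mem_borel i []), hf i⟩
    | zero => simp
    | add x y _ _ hx hy =>
      exact ⟨add_mem hx.1 hy.1, fun z hz => by
        rw [add_lie]; exact add_mem (hx.2 z hz) (hy.2 z hz)⟩
    | smul c x _ hx =>
      exact ⟨S.smul_mem c hx.1, fun z hz => by rw [smul_lie]; exact S.smul_mem c (hx.2 z hz)⟩
    | lie x y _ _ hx hy =>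
      refine ⟨hx.2 y hy.1, fun z hz => ?_⟩
      rw [lie_lie]
      exact sub_mem (hx.2 _ (hy.2 z hz)) (hy.2 _ (hx.2 z hz))
  exact fun x hx => (key x hx).1

/-- The homogeneous components of the grading subalgebra are spanned by coroots and words. -/
theorem mem_of_mem_component (D : TripleGrading α L) (hα : IsBaseB α) {γ : Lattice r}
    {T : Submodule ℂ L} (h0 : γ = 0 → ∀ i, D.h i ∈ T)
    (hpos : ∀ i l, (l.map α).sum + α i = γ → D.word i l ∈ T) (hneg : 0 ≤ hα.height γ)
    {x : L} (hx : x ∈ D.subalgebra.toSubmodule ⊓ D.G γ) : x ∈ T := by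
  classical
  have hx1 := D.subalgebra_le_sup hα hx.1
  rw [borel, borel, ← Submodule.span_union] at hx1
  refine mem_of_mem_span_homogeneous (D.isInternal hα) ?_ hx1 hx.2
  have hle : ∀ l : List (Fin r), hα.height (l.map fun i => -α i).sum ≤ 0 := by
    intro l
    induction l with
    | nil => simp
    | cons j l ih =>
      rw [List.map_cons, List.sum_cons, map_add, map_neg, hα.height_self]
      omega
  rintro y ((⟨i, rfl⟩ | ⟨⟨i, l⟩, rfl⟩) | (⟨i, rfl⟩ | ⟨⟨i, l⟩, rfl⟩))
  · exact ⟨0, D.h_mem i, fun h => h0 h.symm i⟩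
  · exact ⟨_, D.word_mem i l, hpos i l⟩
  · exact ⟨0, (D.symm hα.mem).h_mem i, fun h => neg_mem (h0 h.symm i)⟩
  · refine ⟨_, (D.symm hα.mem).word_mem i l, fun h => ?_⟩
    rw [← h, map_add, map_neg, hα.height_self] at hneg
    have := hle l
    omega

theorem height_sum (hα : IsBaseB α) (l : List (Fin r)) :
    hα.height (l.map α).sum = l.length := by
  induction l with
  | nil => simp
  | cons j l ih =>
    rw [List.map_cons, List.sum_cons, map_add, hα.height_self, ih, List.length_cons]
    push_cast
    ring

theorem component_simple_le (D : TripleGrading α L) (hα : IsBaseB α) (i : Fin r) :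
    D.subalgebra.toSubmodule ⊓ D.G (α i) ≤ Submodule.span ℂ {D.e i} := by
  refine fun x hx => D.mem_of_mem_component hα (fun h => ?_) (fun j l h => ?_) (by simp) hx
  · exact absurd h (ne_zero_of_mem_rootsB (hα.mem i))
  · have hh := congrArg hα.height h
    rw [map_add, hα.height_self, hα.height_self, height_sum] at hh
    have : l.length = 0 := by omega
    obtain rfl := List.length_eq_zero_iff.mp this
    obtain rfl : j = i := hα.injective (by simpa using h)
    exact Submodule.mem_span_singleton_self _

theorem component_two_smul_simple (D : TripleGrading α L) (hα : IsBaseB α) (i : Fin r) :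
    D.subalgebra.toSubmodule ⊓ D.G ((2 : ℤ) • α i) = ⊥ := by
  refine eq_bot_iff.mpr fun x hx =>
    D.mem_of_mem_component hα (fun h => ?_) (fun j l h => ?_)
      (by rw [map_smul, hα.height_self]; decide) hx
  · exact absurd h (smul_ne_zero two_ne_zero (ne_zero_of_mem_rootsB (hα.mem i)))
  · have hh := congrArg hα.height h
    rw [map_add, map_smul, hα.height_self, hα.height_self, height_sum, smul_eq_mul] at hh
    have : l.length = 1 := by omega
    obtain ⟨k, rfl⟩ := List.length_eq_one_iff.mp this
    have hrepr := fun m => congrArg (fun v => hα.basis.repr v m) h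
    simp only [List.map_cons, List.map_nil, List.sum_cons, List.sum_nil, add_zero, map_add,
      map_smul, Finsupp.add_apply, Finsupp.smul_apply, hα.repr_self, smul_eq_mul] at hrepr
    have h1 := hrepr i
    have hj : j = i := by by_contra hj; rw [if_neg hj] at h1; grind
    have hk : k = i := by by_contra hk; grind
    subst hj hk
    change ⁅D.e _, D.e _⁆ ∈ _
    rw [lie_self]
    exact zero_mem _

theorem component_zero_le (D : TripleGrading α L) (hα : IsBaseB α) :
    D.subalgebra.toSubmodule ⊓ D.G 0 ≤ Submodule.span ℂ (Set.range D.h) := by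
  refine fun x hx => D.mem_of_mem_component hα (fun _ i =>
    Submodule.subset_span (Set.mem_range_self i)) (fun j l h => ?_) (by simp) hx
  have hh := congrArg hα.height h
  rw [map_add, hα.height_self, height_sum, map_zero] at hh
  omega

/-- A property of weights which is stable under simple reflections and holds for the simple roots
and their doubles holds on all of `Δ`. -/
theorem _root_.IMAlg.IsBaseB.rootBC_induction (hα : IsBaseB α) {P : Lattice r → Prop}
    (base : ∀ i, P (α i)) (base_two : ∀ i, P ((2 : ℤ) • α i))
    (step : ∀ i v, P v → P (reflect (α i) v)) {β : Lattice r} (hβ : β ∈ rootsBC r) : P β := by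
  rcases mem_rootsBC_iff.mp hβ with hβ | ⟨w, hw, rfl⟩
  · exact hα.root_induction base step hβ
  · have := hα.root_induction (P := fun v => P ((2 : ℤ) • v)) base_two
      (fun i v hv => by rw [← reflect_smul (hα.mem i)]; exact step i _ hv)
      (Or.inr hw : w ∈ rootsB r)
    exact_mod_cast this

theorem component_two_smul (D : TripleGrading α L) (hα : IsBaseB α) {w : Lattice r}
    (hw : w ∈ rootsB r) : D.subalgebra.toSubmodule ⊓ D.G ((2 : ℤ) • w) = ⊥ :=
  hα.root_induction (P := fun w => D.subalgebra.toSubmodule ⊓ D.G ((2 : ℤ) • w) = ⊥)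
    (D.component_two_smul_simple hα)
    (fun i v hv => by
      rw [← reflect_smul (hα.mem i)]
      exact D.inf_eq_bot_of_reflect hα.mem D.stable_subalgebra i hv) hw

theorem component_ne_bot (D : TripleGrading α L) (hα : IsBaseB α) {γ : Lattice r}
    (hγ : γ ∈ rootsB r) : D.subalgebra.toSubmodule ⊓ D.G γ ≠ ⊥ := by
  refine hα.root_induction (P := fun γ => D.subalgebra.toSubmodule ⊓ D.G γ ≠ ⊥)
    (fun i h => ?_) (fun i v hv h => hv ?_) hγ
  · exact D.e_ne_zero i ((Submodule.eq_bot_iff _).mp h _ ⟨D.e_mem_subalgebra i, D.e_mem i⟩)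
  · rw [← reflect_reflect (hα.mem i) v]
    exact D.inf_eq_bot_of_reflect hα.mem D.stable_subalgebra i h

theorem finite_component (D : TripleGrading α L) (hα : IsBaseB α) (γ : Lattice r) :
    Module.Finite ℂ ↥(D.subalgebra.toSubmodule ⊓ D.G γ) := by
  have hbot : Module.Finite ℂ (⊥ : Submodule ℂ L) := inferInstance
  by_cases hγ : γ ∈ rootsBC r ∪ {0}
  · rcases hγ with hγ | rfl
    · refine hα.rootBC_induction (P := fun γ => Module.Finite ℂ
        ↥(D.subalgebra.toSubmodule ⊓ D.G γ)) (fun i => ?_) (fun i => ?_)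
        (fun i v hv => D.finite_inf_of_reflect hα.mem D.stable_subalgebra i hv) hγ
      · exact Submodule.finiteDimensional_of_le (D.component_simple_le hα i)
      · rwa [D.component_two_smul_simple hα i]
    · have : Module.Finite ℂ ↥(Submodule.span ℂ (Set.range D.h)) :=
        FiniteDimensional.span_of_finite ℂ (Set.finite_range _)
      exact Submodule.finiteDimensional_of_le (D.component_zero_le hα)
  · rwa [D.eq_bot γ hγ, inf_bot_eq]

theorem subalgebra_le_iSup (D : TripleGrading α L) :
    D.subalgebra.toSubmodule ≤ ⨆ γ, D.subalgebra.toSubmodule ⊓ D.G γ := by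
  refine fun x hx => lieSpan_le_iSup (V := fun γ => D.subalgebra.toSubmodule ⊓ D.G γ)
    (fun γ δ x hx y hy =>
    ⟨D.subalgebra.lie_mem hx.1 hy.1, D.lie_mem _ _ _ hx.2 _ hy.2⟩) ?_ hx
  rintro _ (⟨i, rfl⟩ | ⟨i, rfl⟩)
  · exact ⟨_, D.e_mem_subalgebra i, D.e_mem i⟩
  · exact ⟨_, D.f_mem_subalgebra i, D.f_mem i⟩

theorem finite_subalgebra (D : TripleGrading α L) (hα : IsBaseB α) :
    Module.Finite ℂ D.subalgebra := by
  have hfin : Finite ↥(rootsBC r ∪ {0}) :=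
    (finite_rootsBC.union (Set.finite_singleton 0)).to_subtype
  have h1 := fun γ : ↥(rootsBC r ∪ {0}) => D.finite_component hα γ
  have h2 : Module.Finite ℂ ↥(⨆ γ : ↥(rootsBC r ∪ {0}), D.subalgebra.toSubmodule ⊓ D.G γ) :=
    Submodule.finiteDimensional_iSup _
  refine Submodule.finiteDimensional_of_le (S₂ := ⨆ γ : ↥(rootsBC r ∪ {0}),
    D.subalgebra.toSubmodule ⊓ D.G γ) (D.subalgebra_le_iSup.trans (iSup_le fun γ => ?_))
  by_cases hγ : γ ∈ rootsBC r ∪ {0}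
  · exact le_iSup (fun γ : ↥(rootsBC r ∪ {0}) => D.subalgebra.toSubmodule ⊓ D.G γ) ⟨γ, hγ⟩
  · rw [D.eq_bot γ hγ, inf_bot_eq]
    exact bot_le

end TripleGrading

/-! ### Nondegeneracy of the pairing -/

section Pairing

variable {r : ℕ} {α : Fin r → Lattice r}

theorem corootPairing_eq_sum {a : Lattice r} (ha : a ∈ rootsB r) (v : Lattice r) :
    corootPairing a v = ∑ i, v i * corootPairing a (eps i) :=
  corootPairing_eq_of_mul ha <| by
    rw [Finset.sum_mul]
    simp only [mul_assoc, corootPairing_mul ha, dotProduct_eps]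
    rw [dotProduct, Finset.mul_sum]
    exact Finset.sum_congr rfl fun i _ => by ring

theorem IsBaseB.eq_zero_of_forall_sum_apply_mul (hα : IsBaseB α) {c : Fin r → ℂ}
    (hc : ∀ j, ∑ k, (α j k : ℂ) * c k = 0) : c = 0 := by
  have key : ∀ v : Lattice r, ∑ k, (v k : ℂ) * c k = 0 := by
    intro v
    rw [← hα.sum_repr v]
    simp only [Finset.sum_apply, Pi.smul_apply, smul_eq_mul, Int.cast_sum, Int.cast_mul,
      Finset.sum_mul]
    rw [Finset.sum_comm]
    refine Finset.sum_eq_zero fun j _ => ?_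
    simp only [mul_assoc]
    rw [← Finset.mul_sum, hc j, mul_zero]
  ext k
  simpa [eps_apply] using key (eps k)

theorem IsBaseB.eq_zero_of_forall_sum_mul_apply (hα : IsBaseB α) {c : Fin r → ℂ}
    (hc : ∀ k, ∑ j, c j * (α j k : ℂ) = 0) : c = 0 := by
  ext i
  have h1 : ∀ j, hα.basis.repr (α j) i = ∑ k, α j k * hα.basis.repr (eps k) i := by
    intro j
    have : α j = ∑ k, α j k • eps k := by
      ext l
      simp [eps_apply]
    conv_lhs => rw [this]
    rw [map_sum, Finsupp.finsetSum_apply]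
    exact Finset.sum_congr rfl fun k _ => by rw [map_smul, Finsupp.smul_apply, smul_eq_mul]
  have h2 : ∑ k, (∑ j, c j * (α j k : ℂ)) * (hα.basis.repr (eps k) i : ℂ) = c i := by
    simp only [Finset.sum_mul]
    rw [Finset.sum_comm]
    have : ∀ j, ∑ k, c j * (α j k : ℂ) * (hα.basis.repr (eps k) i : ℂ) =
        c j * ((hα.basis.repr (α j) i : ℤ) : ℂ) := fun j => by
      rw [h1 j]
      push_cast
      rw [Finset.mul_sum]
      exact Finset.sum_congr rfl fun k _ => by ring
    simp [this, hα.repr_self]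
  rw [← h2]
  simp [hc]

theorem corootPairing_eps {a : Lattice r} (ha : a ∈ rootsB r) (k : Fin r) :
    (corootPairing a (eps k) : ℂ) = 2 / ((a ⬝ᵥ a : ℤ) : ℂ) * (a k : ℂ) := by
  have h1 := corootPairing_mul ha (eps k)
  have h2 : ((a ⬝ᵥ a : ℤ) : ℂ) ≠ 0 := by exact_mod_cast (dotProduct_self_pos ha).ne'
  rw [dotProduct_eps] at h1
  rw [div_mul_eq_mul_div, eq_div_iff h2]
  exact_mod_cast h1

theorem IsBaseB.eq_zero_of_forall_sum_mul_corootPairing (hα : IsBaseB α) {c : Fin r → ℂ}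
    (hc : ∀ i, ∑ j, c j * (corootPairing (α j) (α i) : ℂ) = 0) : c = 0 := by
  have h1 : ∀ v : Lattice r, ∑ j, c j * (corootPairing (α j) v : ℂ) = 0 := by
    intro v
    have hv : v ∈ Submodule.span ℤ (Set.range α) := hα.span_eq_top ▸ Submodule.mem_top
    induction hv using Submodule.span_induction with
    | mem x hx => obtain ⟨i, rfl⟩ := hx; exact hc i
    | zero => simp [corootPairing_zero]
    | add x y _ _ hx hy =>
      simp only [corootPairing_add (hα.mem _), Int.cast_add, mul_add, Finset.sum_add_distrib, hx,
        hy, add_zero]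
    | smul n x _ hx =>
      simp only [corootPairing_zsmul (hα.mem _), Int.cast_mul, mul_left_comm _ (n : ℂ)]
      rw [← Finset.mul_sum, hx, mul_zero]
  have h2 := hα.eq_zero_of_forall_sum_mul_apply
    (c := fun j => c j * (2 / ((α j ⬝ᵥ α j : ℤ) : ℂ))) fun k => by
      simpa only [corootPairing_eps (hα.mem _), mul_assoc] using h1 (eps k)
  ext j
  have h3 : ((α j ⬝ᵥ α j : ℤ) : ℂ) ≠ 0 := by exact_mod_cast (dotProduct_self_pos (hα.mem j)).ne'
  exact (mul_eq_zero.mp (congrFun h2 j)).resolve_right (div_ne_zero two_ne_zero h3)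

end Pairing

namespace TripleGrading

variable {r : ℕ} {α : Fin r → Lattice r} {L : Type*} [LieRing L] [LieAlgebra ℂ L]

theorem eq_of_mem (D : TripleGrading α L) (hα : IsBaseB α) {γ δ : Lattice r} {x : L}
    (hx0 : x ≠ 0) (hγ : x ∈ D.G γ) (hδ : x ∈ D.G δ) : γ = δ := by
  by_contra h
  obtain ⟨j, hj⟩ := exists_corootPairing_ne hα h
  have h1 := (D.lie_h j _ _ hγ).symm.trans (D.lie_h j _ _ hδ)
  exact hj (by exact_mod_cast smul_left_injective ℂ hx0 h1)

/-! ### The Cartan subalgebra -/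

theorem span_h_le (D : TripleGrading α L) : Submodule.span ℂ (Set.range D.h) ≤ D.G 0 :=
  Submodule.span_le.mpr (by rintro _ ⟨i, rfl⟩; exact D.h_mem i)

theorem lie_h_zero (D : TripleGrading α L) (i : Fin r) {x : L} (hx : x ∈ D.G 0) :
    ⁅D.h i, x⁆ = 0 := by
  rw [D.lie_h i _ _ hx, corootPairing_zero, Int.cast_zero, zero_smul]

theorem lie_eq_zero_of_mem_span_h (D : TripleGrading α L) {x y : L}
    (hx : x ∈ Submodule.span ℂ (Set.range D.h)) (hy : y ∈ D.G 0) : ⁅x, y⁆ = 0 := by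
  obtain ⟨c, rfl⟩ := (Submodule.mem_span_range_iff_exists_fun ℂ).mp hx
  simp [sum_lie, D.lie_h_zero _ hy]

theorem linearIndependent_h (D : TripleGrading α L) (hα : IsBaseB α) :
    LinearIndependent ℂ D.h := by
  rw [Fintype.linearIndependent_iff]
  intro c hc
  refine congrFun (hα.eq_zero_of_forall_sum_mul_corootPairing fun i => ?_)
  have h1 : ⁅∑ j, c j • D.h j, D.e i⁆ = 0 := by rw [hc, zero_lie]
  simp only [sum_lie, smul_lie, D.lie_h _ _ _ (D.e_mem i), smul_smul] at h1
  rw [← Finset.sum_smul] at h1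
  exact (smul_eq_zero.mp h1).resolve_right (D.e_ne_zero i)

/-- The Cartan subalgebra spanned by the coroots. -/
def cartan (D : TripleGrading α L) : LieSubalgebra ℂ D.subalgebra where
  __ := (Submodule.span ℂ (Set.range D.h)).comap D.subalgebra.toSubmodule.subtype
  lie_mem' {x y} hx hy := by
    change ⁅(x : L), (y : L)⁆ ∈ Submodule.span ℂ (Set.range D.h)
    rw [D.lie_eq_zero_of_mem_span_h (x := (x : L)) (y := (y : L)) hx (D.span_h_le hy)]
    exact zero_mem _

theorem mem_cartan (D : TripleGrading α L) {x : D.subalgebra} :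
    x ∈ D.cartan ↔ (x : L) ∈ Submodule.span ℂ (Set.range D.h) := Iff.rfl

/-- The coroots as elements of the Cartan subalgebra. -/
def cartanH (D : TripleGrading α L) (i : Fin r) : D.cartan :=
  ⟨⟨D.h i, D.h_mem_subalgebra i⟩, D.mem_cartan.mpr (Submodule.subset_span ⟨i, rfl⟩)⟩

/-- The inclusion of the Cartan subalgebra. -/
def cartanIncl (D : TripleGrading α L) : D.cartan →ₗ[ℂ] L :=
  D.subalgebra.toSubmodule.subtype ∘ₗ D.cartan.toSubmodule.subtype

theorem cartanIncl_injective (D : TripleGrading α L) : Function.Injective D.cartanIncl :=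
  fun _ _ h => Subtype.ext (Subtype.ext h)

theorem cartanIncl_cartanH (D : TripleGrading α L) (i : Fin r) :
    D.cartanIncl (D.cartanH i) = D.h i := rfl

/-- The basis of the Cartan subalgebra formed by the coroots. -/
def cartanBasis (D : TripleGrading α L) (hα : IsBaseB α) : Module.Basis (Fin r) ℂ D.cartan :=
  Module.Basis.mk (v := D.cartanH)
    (LinearIndependent.of_comp D.cartanIncl (D.linearIndependent_h hα))
    (fun x _ => by
      obtain ⟨c, hc⟩ := (Submodule.mem_span_range_iff_exists_fun ℂ).mp (D.mem_cartan.mp x.2)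
      refine (Submodule.mem_span_range_iff_exists_fun ℂ).mpr ⟨c, D.cartanIncl_injective ?_⟩
      rw [map_sum]
      simp only [map_smul, cartanIncl_cartanH]
      exact hc)

@[simp] theorem cartanBasis_apply (D : TripleGrading α L) (hα : IsBaseB α) (i : Fin r) :
    D.cartanBasis hα i = D.cartanH i := by simp [cartanBasis]

theorem isCartanSubalgebra (D : TripleGrading α L) (hα : IsBaseB α) :
    D.cartan.IsCartanSubalgebra := by
  have hab : IsLieAbelian D.cartan := ⟨fun x y => D.cartanIncl_injective <| by
    change ⁅D.cartanIncl x, D.cartanIncl y⁆ = 0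
    exact D.lie_eq_zero_of_mem_span_h (D.mem_cartan.mp x.2) (D.span_h_le (D.mem_cartan.mp y.2))⟩
  refine ⟨inferInstance, le_antisymm (fun x hx => ?_) (LieSubalgebra.le_normalizer _)⟩
  rw [LieSubalgebra.mem_normalizer_iff] at hx
  obtain ⟨s, y, hy, hsum⟩ := D.exists_components (x : L)
  have hz : ∀ γ ∈ s, γ ≠ 0 → y γ = 0 := by
    intro γ hγ h0
    obtain ⟨j, hj⟩ := exists_corootPairing_ne hα h0
    rw [corootPairing_zero] at hj
    have h1 : ⁅D.h j, (x : L)⁆ ∈ Submodule.span ℂ (Set.range D.h) := by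
      rw [← lie_skew]
      exact neg_mem (D.mem_cartan.mp (hx _ (D.cartanH j).2))
    rw [← hsum, lie_sum, Finset.sum_congr rfl fun γ _ => D.lie_h j _ _ (hy γ)] at h1
    have h2 := D.component_mem hα (U := Submodule.span ℂ (Set.range D.h))
      (fun i x hx => by rw [D.lie_h_zero i (D.span_h_le hx)]; exact zero_mem _) s
      (fun γ => (corootPairing (α j) γ : ℂ) • y γ) (fun γ => (D.G γ).smul_mem _ (hy γ)) h1 γ hγ
    have h3 := ((Submodule.span ℂ (Set.range D.h)).smul_mem_iff (by exact_mod_cast hj)).mp h2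
    by_contra hy0
    exact h0 (D.eq_of_mem hα hy0 (hy γ) (D.span_h_le h3))
  refine D.mem_cartan.mpr (D.component_zero_le hα ⟨x.2, ?_⟩)
  rw [← hsum]
  refine Submodule.sum_mem _ fun γ hγ => ?_
  by_cases h0 : γ = 0
  · exact h0 ▸ hy γ
  · rw [hz γ hγ h0]
    exact zero_mem _

/-- The functionals `ε_i` on the Cartan subalgebra. -/
def epsFunctional (D : TripleGrading α L) (hα : IsBaseB α) (k : Fin r) :
    Module.Dual ℂ D.cartan :=
  (D.cartanBasis hα).constr ℂ fun j => (corootPairing (α j) (eps k) : ℂ)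

theorem epsFunctional_cartanH (D : TripleGrading α L) (hα : IsBaseB α) (k j : Fin r) :
    D.epsFunctional hα k (D.cartanH j) = corootPairing (α j) (eps k) := by
  rw [← D.cartanBasis_apply hα, epsFunctional, Module.Basis.constr_basis]

theorem linearIndependent_epsFunctional (D : TripleGrading α L) (hα : IsBaseB α) :
    LinearIndependent ℂ (D.epsFunctional hα) := by
  rw [Fintype.linearIndependent_iff]
  intro c hc
  refine congrFun (hα.eq_zero_of_forall_sum_apply_mul fun j => ?_)
  have h1 := LinearMap.congr_fun hc (D.cartanH j)
  simp only [LinearMap.sum_apply, LinearMap.smul_apply, epsFunctional_cartanH, smul_eq_mul,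
    corootPairing_eps (hα.mem j), LinearMap.zero_apply] at h1
  have h2 : (2 / ((α j ⬝ᵥ α j : ℤ) : ℂ)) ≠ 0 :=
    div_ne_zero two_ne_zero (by exact_mod_cast (dotProduct_self_pos (hα.mem j)).ne')
  refine (mul_eq_zero.mp ?_).resolve_left h2
  rw [← h1, Finset.mul_sum]
  exact Finset.sum_congr rfl fun k _ => by ring

/-- The basis `ε_1, …, ε_r` of the dual of the Cartan subalgebra. -/
def epsBasis (D : TripleGrading α L) (hα : IsBaseB α) :
    Module.Basis (Fin r) ℂ (Module.Dual ℂ D.cartan) :=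
  have : Module.Finite ℂ D.cartan := Module.Finite.of_basis (D.cartanBasis hα)
  Module.Basis.mk (D.linearIndependent_epsFunctional hα)
    ((D.linearIndependent_epsFunctional hα).span_eq_top_of_card_eq_finrank' (by
      rw [Subspace.dual_finrank_eq, Module.finrank_eq_card_basis (D.cartanBasis hα)])).ge

theorem toFunctional_cartanH (D : TripleGrading α L) (hα : IsBaseB α) (μ : Lattice r)
    (j : Fin r) : toFunctional (D.epsBasis hα) μ (D.cartanH j) = corootPairing (α j) μ := by
  rw [corootPairing_eq_sum (hα.mem j)]
  simp only [toFunctional, epsBasis, LinearMap.sum_apply, LinearMap.smul_apply,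
    Module.Basis.mk_apply, epsFunctional_cartanH, Int.cast_sum, Int.cast_mul, zsmul_eq_mul]

theorem weightSpace_eq (D : TripleGrading α L) (hα : IsBaseB α) (μ : Lattice r) :
    weightSpace D.cartan (toFunctional (D.epsBasis hα) μ) = D.G μ := by
  refine le_antisymm (fun x hx => ?_) (fun x hx h => ?_)
  · by_cases hx0 : x = 0
    · rw [hx0]
      exact zero_mem _
    obtain ⟨γ, hγ, h1⟩ := D.exists_mem_of_eigenvector hα hx0 (fun i => hx (D.cartanH i))
    by_cases h : μ = γ
    · exact h ▸ hγ
    · obtain ⟨j, hj⟩ := exists_corootPairing_ne hα h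
      have h2 := h1 j
      rw [D.toFunctional_cartanH hα] at h2
      exact absurd (by exact_mod_cast h2) hj
  · have key : (LieModule.toEnd ℂ L L : L →ₗ[ℂ] Module.End ℂ L).flip x ∘ₗ D.cartanIncl =
        (toFunctional (D.epsBasis hα) μ).smulRight x := (D.cartanBasis hα).ext fun j => by
      simp only [LinearMap.comp_apply, LinearMap.smulRight_apply, cartanBasis_apply,
        D.toFunctional_cartanH hα, cartanIncl_cartanH]
      exact D.lie_h j _ _ hx
    exact LinearMap.congr_fun key h

theorem toFunctional_zero (D : TripleGrading α L) (hα : IsBaseB α) :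
    toFunctional (D.epsBasis hα) 0 = 0 := by simp [toFunctional]

theorem toFunctional_ne_zero (D : TripleGrading α L) (hα : IsBaseB α) {γ : Lattice r}
    (hγ : γ ≠ 0) : toFunctional (D.epsBasis hα) γ ≠ 0 := by
  intro h
  obtain ⟨j, hj⟩ := exists_corootPairing_ne hα hγ
  have h1 := D.toFunctional_cartanH hα γ j
  rw [h, LinearMap.zero_apply] at h1
  rw [corootPairing_zero] at hj
  exact hj (by exact_mod_cast h1.symm)

theorem lie_eq_smul_of_mem (D : TripleGrading α L) (hα : IsBaseB α) {γ : Lattice r} {x : L}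
    (hx : x ∈ D.G γ) (h : D.cartan) :
    ⁅((h : D.subalgebra) : L), x⁆ = toFunctional (D.epsBasis hα) γ h • x := by
  rw [← D.weightSpace_eq hα] at hx
  exact hx h

theorem hasRootSystemB (D : TripleGrading α L) (hα : IsBaseB α) :
    haveI := D.isCartanSubalgebra hα
    HasRootSystemB D.cartan (D.epsBasis hα) := by
  have := D.isCartanSubalgebra hα
  have := D.finite_subalgebra hα
  ext φ
  constructor
  · rintro ⟨hφ, hne⟩
    obtain ⟨m, hm0, hm⟩ := LieModule.exists_forall_lie_eq_smul ℂ D.cartan D.subalgebra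
      ⟨φ, hne⟩
    have hm0' : (m : L) ≠ 0 := fun h => hm0 (Subtype.ext h)
    have hmL : ∀ h : D.cartan, ⁅((h : D.subalgebra) : L), (m : L)⁆ = φ h • (m : L) :=
      fun h => congrArg Subtype.val (hm h)
    obtain ⟨γ, hγ, h1⟩ := D.exists_mem_of_eigenvector hα hm0' (fun i => hmL (D.cartanH i))
    have hφγ : toFunctional (D.epsBasis hα) γ = φ := (D.cartanBasis hα).ext fun j => by
      rw [cartanBasis_apply, D.toFunctional_cartanH hα, ← h1 j]
    refine ⟨γ, ?_, hφγ⟩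
    rcases D.mem_support hγ hm0' with h | rfl
    · rcases mem_rootsBC_iff.mp h with h | ⟨w, hw, rfl⟩
      · exact h
      · have h2 := D.component_two_smul hα (Or.inr hw : w ∈ rootsB r)
        refine absurd ((Submodule.eq_bot_iff _).mp h2 m ⟨m.2, ?_⟩) hm0'
        exact_mod_cast hγ
    · exact absurd (hφγ.symm.trans (D.toFunctional_zero hα)) hφ
  · rintro ⟨γ, hγ, rfl⟩
    refine ⟨D.toFunctional_ne_zero hα (ne_zero_of_mem_rootsB hγ), fun h => ?_⟩
    obtain ⟨x, ⟨hxg, hx⟩, hx0⟩ := (Submodule.ne_bot_iff _).mp (D.component_ne_bot hα hγ)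
    have h1 : (⟨x, hxg⟩ : D.subalgebra) ∈
        LieModule.weightSpace D.subalgebra (toFunctional (D.epsBasis hα) γ) := by
      rw [LieModule.mem_weightSpace]
      exact fun h => Subtype.ext (D.lie_eq_smul_of_mem hα hx h)
    have h2 := LieModule.weightSpace_le_genWeightSpace D.subalgebra _ h1
    have h3 := (LieSubmodule.eq_bot_iff _).mp h _ h2
    exact hx0 (congrArg Subtype.val h3)

/-! ### Simplicity -/

theorem exists_e_mem (D : TripleGrading α L) (hα : IsBaseB α) {U : Submodule ℂ L}
    (hU : D.Stable U) (hle : U ≤ D.subalgebra.toSubmodule) (hne : U ≠ ⊥) :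
    ∃ i, D.e i ∈ U := by
  by_contra! hc
  have hsimple : ∀ i, U ⊓ D.G (α i) = ⊥ := fun i => (Submodule.eq_bot_iff _).mpr fun x hx => by
    obtain ⟨c, rfl⟩ := Submodule.mem_span_singleton.mp
      (D.component_simple_le hα i ⟨hle hx.1, hx.2⟩)
    by_cases h0 : c = 0
    · rw [h0, zero_smul]
    · exact absurd ((U.smul_mem_iff h0).mp hx.1) (hc i)
  have htwo : ∀ i, U ⊓ D.G ((2 : ℤ) • α i) = ⊥ := fun i =>
    eq_bot_iff.mpr ((inf_le_inf_right _ hle).trans (D.component_two_smul_simple hα i).le)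
  have hall : ∀ γ, U ⊓ D.G γ = ⊥ := by
    intro γ
    by_cases hγ : γ ∈ rootsBC r ∪ {0}
    · rcases hγ with hγ | rfl
      · exact hα.rootBC_induction (P := fun γ => U ⊓ D.G γ = ⊥) hsimple htwo
          (fun i v hv => D.inf_eq_bot_of_reflect hα.mem hU i hv) hγ
      · refine (Submodule.eq_bot_iff _).mpr fun x hx => ?_
        obtain ⟨c, rfl⟩ := (Submodule.mem_span_range_iff_exists_fun ℂ).mp
          (D.component_zero_le hα ⟨hle hx.1, hx.2⟩)
        have hc0 : c = 0 := hα.eq_zero_of_forall_sum_mul_corootPairing fun i => by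
          have h1 : ⁅∑ j, c j • D.h j, D.e i⁆ ∈ U := by
            rw [← lie_skew]
            exact neg_mem (hU i _ hx.1).1
          simp only [sum_lie, smul_lie, D.lie_h _ _ _ (D.e_mem i), smul_smul] at h1
          rw [← Finset.sum_smul] at h1
          by_contra h0
          exact hc i ((U.smul_mem_iff h0).mp h1)
        simp [hc0]
    · rw [D.eq_bot γ hγ, inf_bot_eq]
  refine hne ((Submodule.eq_bot_iff _).mpr fun x hx => ?_)
  obtain ⟨s, y, hy, rfl⟩ := D.exists_components x
  have h1 := D.component_mem hα (fun i x hx => hU.lie_h_mem i hx) s y hy hx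
  exact Finset.sum_eq_zero fun γ hγ =>
    (Submodule.eq_bot_iff _).mp (hall γ) _ ⟨h1 γ hγ, hy γ⟩

theorem generators_mem (D : TripleGrading α L) (hα : IsBaseB α) {U : Submodule ℂ L}
    (hU : D.Stable U) {i : Fin r} (hi : D.e i ∈ U) (j : Fin r) : D.e j ∈ U ∧ D.f j ∈ U := by
  have hh : ∀ k, D.e k ∈ U → D.h k ∈ U := fun k hk => by
    rw [← D.lie_e_f, ← lie_skew]
    exact neg_mem (hU k _ hk).2
  have hJ : {k | D.e k ∈ U} = Set.univ :=
    hα.eq_univ_of_closed ⟨i, hi⟩ fun k hk l hkl => by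
      have h1 : ⁅D.h k, D.e l⁆ ∈ U := by
        rw [← lie_skew]
        exact neg_mem (hU l _ (hh k hk)).1
      rw [D.lie_h k _ _ (D.e_mem l)] at h1
      refine (U.smul_mem_iff ?_).mp h1
      exact_mod_cast fun h => hkl ((corootPairing_eq_zero_iff (hα.mem k)).mp h)
  have hj : D.e j ∈ U := hJ.ge (Set.mem_univ j)
  refine ⟨hj, ?_⟩
  have h1 : ⁅D.h j, D.f j⁆ ∈ U := by
    rw [← lie_skew]
    exact neg_mem (hU j _ (hh j hj)).2
  rw [D.lie_h j _ _ (D.f_mem j), corootPairing_neg (hα.mem j), corootPairing_self (hα.mem j)] at h1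
  exact (U.smul_mem_iff (by norm_num)).mp h1

theorem isSimple_subalgebra (D : TripleGrading α L) (hα : IsBaseB α) [Nonempty (Fin r)] :
    LieAlgebra.IsSimple ℂ D.subalgebra where
  eq_bot_or_eq_top I := by
    refine or_iff_not_imp_left.mpr fun hI => ?_
    set U : Submodule ℂ L := I.toSubmodule.map D.subalgebra.toSubmodule.subtype with hUdef
    have hmem : ∀ x : D.subalgebra, (x : L) ∈ U ↔ x ∈ I := fun x => by
      constructor
      · rintro ⟨y, hy, hyx⟩
        obtain rfl : y = x := Subtype.ext hyx
        exact hy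
      · exact fun hx => ⟨x, hx, rfl⟩
    have hlie : ∀ a ∈ D.subalgebra, ∀ x ∈ U, ⁅a, x⁆ ∈ U := by
      rintro a ha _ ⟨y, hy, rfl⟩
      exact (hmem ⁅(⟨a, ha⟩ : D.subalgebra), y⁆).mpr (lie_mem_right ℂ _ I _ _ hy)
    have hU : D.Stable U := fun i x hx =>
      ⟨hlie _ (D.e_mem_subalgebra i) x hx, hlie _ (D.f_mem_subalgebra i) x hx⟩
    have hle : U ≤ D.subalgebra.toSubmodule := by
      rintro _ ⟨y, -, rfl⟩
      exact y.2
    have hne : U ≠ ⊥ := fun h => hI <| (LieSubmodule.eq_bot_iff _).mpr fun x hx =>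
      Subtype.ext ((Submodule.eq_bot_iff _).mp h x ((hmem x).mpr hx))
    obtain ⟨i, hi⟩ := D.exists_e_mem hα hU hle hne
    have hgen := D.generators_mem hα hU hi
    have hall : ∀ x ∈ D.subalgebra, x ∈ U := by
      intro x hx
      induction hx using LieSubalgebra.lieSpan_induction with
      | mem x hx => rcases hx with ⟨j, rfl⟩ | ⟨j, rfl⟩; exacts [(hgen j).1, (hgen j).2]
      | zero => exact zero_mem _
      | add x y _ _ hx hy => exact add_mem hx hy
      | smul c x _ hx => exact U.smul_mem c hx
      | lie x y hxs _ _ hy => exact hlie x hxs y hy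
    exact eq_top_iff.mpr fun x _ => (hmem x).mp (hall x x.2)
  non_abelian := by
    intro hab
    obtain ⟨i⟩ := ‹Nonempty (Fin r)›
    have h1 := hab.trivial ⟨D.h i, D.h_mem_subalgebra i⟩ ⟨D.e i, D.e_mem_subalgebra i⟩
    have h2 : ⁅D.h i, D.e i⁆ = 0 := congrArg Subtype.val h1
    rw [D.lie_h i _ _ (D.e_mem i), corootPairing_self (hα.mem i)] at h2
    exact D.e_ne_zero i ((smul_eq_zero.mp h2).resolve_left (by norm_num))

/-! ### The zero component -/

theorem lie_mem_iSup_bracketSpan (D : TripleGrading α L) {x y : L} (hx : x ∈ D.G 0)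
    (hy : y ∈ ⨆ μ ∈ rootsBC r, bracketSpan (D.G μ) (D.G (-μ))) :
    ⁅x, y⁆ ∈ ⨆ μ ∈ rootsBC r, bracketSpan (D.G μ) (D.G (-μ)) := by
  set B := ⨆ μ ∈ rootsBC r, bracketSpan (D.G μ) (D.G (-μ)) with hB
  have : B ≤ B.comap (LieAlgebra.ad ℂ L x : L →ₗ[ℂ] L) := by
    refine iSup₂_le fun μ hμ => Submodule.span_le.mpr ?_
    rintro _ ⟨y, hy, z, hz, rfl⟩
    have hle : bracketSpan (D.G μ) (D.G (-μ)) ≤ B :=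
      le_iSup₂ (f := fun μ (_ : μ ∈ rootsBC r) => bracketSpan (D.G μ) (D.G (-μ))) μ hμ
    refine hle ?_
    change ⁅x, ⁅y, z⁆⁆ ∈ _
    rw [leibniz_lie]
    refine add_mem (Submodule.subset_span ⟨_, ?_, z, hz, rfl⟩)
      (Submodule.subset_span ⟨y, hy, _, ?_, rfl⟩)
    · simpa using D.lie_mem _ _ _ hx _ hy
    · simpa using D.lie_mem _ _ _ hx _ hz
  exact this hy

theorem zero_component_eq (D : TripleGrading α L) (hα : IsBaseB α) :
    D.G 0 = ⨆ μ ∈ rootsBC r, bracketSpan (D.G μ) (D.G (-μ)) := by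
  classical
  set B := ⨆ μ ∈ rootsBC r, bracketSpan (D.G μ) (D.G (-μ)) with hB
  have hle : ∀ μ ∈ rootsBC r, bracketSpan (D.G μ) (D.G (-μ)) ≤ B := fun μ hμ =>
    le_iSup₂ (f := fun μ (_ : μ ∈ rootsBC r) => bracketSpan (D.G μ) (D.G (-μ))) μ hμ
  have hB0 : B ≤ D.G 0 := iSup₂_le fun μ _ => Submodule.span_le.mpr <| by
    rintro _ ⟨y, hy, z, hz, rfl⟩
    simpa using D.lie_mem _ _ _ hy _ hz
  refine le_antisymm (fun x hx => ?_) hB0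
  set V : Lattice r → Submodule ℂ L := fun γ => if γ = 0 then B else D.G γ with hV
  have hV0 : V 0 = B := if_pos rfl
  have hVne : ∀ γ, γ ≠ 0 → V γ = D.G γ := fun γ h => if_neg h
  have hVG : ∀ γ, V γ ≤ D.G γ := fun γ => by
    by_cases h : γ = 0
    · subst h
      rwa [hV0]
    · rw [hVne γ h]
  have hlie : ∀ γ δ, ∀ x ∈ V γ, ∀ y ∈ V δ, ⁅x, y⁆ ∈ V (γ + δ) := by
    intro γ δ x hx y hy
    by_cases hγδ : γ + δ = 0
    · rw [hγδ, hV0]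
      by_cases hγ : γ = 0
      · subst hγ
        obtain rfl : δ = 0 := by simpa using hγδ
        rw [hV0] at hy
        exact D.lie_mem_iSup_bracketSpan (hVG 0 hx) hy
      · obtain rfl : δ = -γ := (neg_eq_of_add_eq_zero_right hγδ).symm
        by_cases hx0 : x = 0
        · rw [hx0, zero_lie]
          exact zero_mem _
        · refine hle γ ?_ (Submodule.subset_span ⟨x, hVG γ hx, y, hVG _ hy, rfl⟩)
          exact (D.mem_support (hVG γ hx) hx0).resolve_right hγ
    · rw [hVne _ hγδ]
      exact D.lie_mem _ _ _ (hVG γ hx) _ (hVG δ hy)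
  have htop : x ∈ ⨆ γ, V γ := by
    refine lieSpan_le_iSup hlie (s := {x | ∃ γ ∈ rootsBC r, x ∈ D.G γ})
      (fun y ⟨γ, hγ, hy⟩ => ⟨γ, ?_⟩) (D.lieSpan_eq_top ▸ LieSubalgebra.mem_top x)
    rwa [hVne γ (ne_zero_of_mem_rootsBC hγ)]
  exact hV0 ▸ mem_of_mem_iSup (D.isInternal hα) hVG htop hx

theorem isBCGraded (D : TripleGrading α L) (hα : IsBaseB α) [Nonempty (Fin r)] :
    IsBCGraded r L := by
  refine ⟨D.subalgebra, D.cartan, D.isCartanSubalgebra hα, D.epsBasis hα, ?_⟩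
  refine @IsBCGradedBy.mk _ _ _ _ _ _ (_) _ (D.finite_subalgebra hα) (D.isSimple_subalgebra hα)
    (D.hasRootSystemB hα) ?_ ?_
  · simp only [D.weightSpace_eq hα]
    refine DirectSum.isInternal_submodule_of_iSupIndep_of_iSup_eq_top
      ((D.isInternal hα).submodule_iSupIndep.comp Subtype.val_injective) ?_
    refine eq_top_iff.mpr (D.iSup_eq_top.ge.trans (iSup_le fun γ => ?_))
    by_cases hγ : γ ∈ rootsBC r ∪ {0}
    · exact le_iSup (fun γ : ↥(rootsBC r ∪ {0}) => D.G γ) ⟨γ, hγ⟩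
    · rw [D.eq_bot γ hγ]
      exact bot_le
  · rw [← D.toFunctional_zero hα]
    simp only [D.weightSpace_eq hα]
    exact D.zero_component_eq hα

end TripleGrading

/-! ### The orthogonal Lie algebra of type `B_r` -/

attribute [local instance] LieRing.ofAssociativeRing LieAlgebra.ofAssociativeAlgebra

section Orthogonal

variable {r : ℕ}

/-- The index set `{0} ∪ {±ε_i}` of the weights of the natural representation. -/
abbrev NatIndex (r : ℕ) : Type := Option (Fin r × ℤˣ)

/-- The weight attached to an index. -/
def natWeight : NatIndex r → Lattice r
  | none => 0
  | some (i, s) => (s : ℤ) • eps i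

/-- The index of the opposite weight. -/
def natNeg : NatIndex r → NatIndex r
  | none => none
  | some (i, s) => some (i, -s)

@[simp] theorem natNeg_natNeg (a : NatIndex r) : natNeg (natNeg a) = a := by
  rcases a with _ | ⟨i, s⟩ <;> simp [natNeg]

@[simp] theorem natWeight_natNeg (a : NatIndex r) : natWeight (natNeg a) = -natWeight a := by
  rcases a with _ | ⟨i, s⟩ <;> simp [natNeg, natWeight]

theorem natNeg_involutive : Function.Involutive (natNeg (r := r)) := natNeg_natNeg

/-- The skew matrices which are homogeneous of degree `γ`: a weight space of the orthogonal Lie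
algebra of the form pairing the index `a` with `natNeg a`. -/
def skewHomogeneous (γ : Lattice r) : Submodule ℂ (Matrix (NatIndex r) (NatIndex r) ℂ) where
  carrier := {X | (∀ a b, X a b = -X (natNeg b) (natNeg a)) ∧
    ∀ a b, X a b ≠ 0 → natWeight a - natWeight b = γ}
  zero_mem' := ⟨fun a b => by simp, fun a b h => by simp at h⟩
  add_mem' {X Y} hX hY := ⟨fun a b => by
    rw [Matrix.add_apply, Matrix.add_apply, hX.1 a b, hY.1 a b, neg_add], fun a b h => by
    by_cases h1 : X a b = 0
    · exact hY.2 a b fun h2 => h (by rw [Matrix.add_apply, h1, h2, add_zero])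
    · exact hX.2 a b h1⟩
  smul_mem' c X hX := ⟨fun a b => by
    rw [Matrix.smul_apply, Matrix.smul_apply, hX.1 a b, smul_neg], fun a b h => hX.2 a b fun h1 =>
      h (by rw [Matrix.smul_apply, h1, smul_zero])⟩

theorem lie_mem_skewHomogeneous {γ δ : Lattice r} {X Y : Matrix (NatIndex r) (NatIndex r) ℂ}
    (hX : X ∈ skewHomogeneous γ) (hY : Y ∈ skewHomogeneous δ) :
    ⁅X, Y⁆ ∈ skewHomogeneous (γ + δ) := by
  constructor
  · intro a b
    have key : ∀ {X Y : Matrix (NatIndex r) (NatIndex r) ℂ},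
        (∀ a b, X a b = -X (natNeg b) (natNeg a)) → (∀ a b, Y a b = -Y (natNeg b) (natNeg a)) →
        (X * Y) a b = (Y * X) (natNeg b) (natNeg a) := by
      intro X Y hX hY
      rw [Matrix.mul_apply, Matrix.mul_apply]
      refine Fintype.sum_equiv natNeg_involutive.toPerm _ _ fun c => ?_
      rw [hX a c, hY c b, neg_mul_neg, mul_comm]
      rfl
    rw [Ring.lie_def, Matrix.sub_apply, Matrix.sub_apply, key hX.1 hY.1, key hY.1 hX.1, neg_sub]
  · intro a b h
    have key : ∀ {γ δ : Lattice r} {X Y : Matrix (NatIndex r) (NatIndex r) ℂ},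
        (∀ a b, X a b ≠ 0 → natWeight a - natWeight b = γ) →
        (∀ a b, Y a b ≠ 0 → natWeight a - natWeight b = δ) → (X * Y) a b ≠ 0 →
        natWeight a - natWeight b = γ + δ := by
      intro γ δ X Y hX hY h
      rw [Matrix.mul_apply] at h
      obtain ⟨c, -, hc⟩ := Finset.exists_ne_zero_of_sum_ne_zero h
      rw [← hX a c (left_ne_zero_of_mul hc), ← hY c b (right_ne_zero_of_mul hc)]
      abel
    rw [Ring.lie_def, Matrix.sub_apply] at h
    by_cases h1 : (X * Y) a b = 0
    · rw [h1, zero_sub, neg_ne_zero] at h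
      rw [key hY.2 hX.2 h, add_comm]
    · exact key hX.2 hY.2 h1

theorem mem_of_skewHomogeneous_ne_zero {γ : Lattice r} {X : Matrix (NatIndex r) (NatIndex r) ℂ}
    (hX : X ∈ skewHomogeneous γ) (h0 : X ≠ 0) : γ ∈ rootsB r ∪ {0} := by
  obtain ⟨a, b, hab⟩ : ∃ a b, X a b ≠ 0 := by
    by_contra! h
    exact h0 (Matrix.ext h)
  rw [← hX.2 a b hab]
  rcases a with _ | ⟨i, s⟩ <;> rcases b with _ | ⟨j, t⟩
  · right
    simp [natWeight]
  · exact Or.inl (Or.inr ⟨j, -t, by simp [natWeight]⟩)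
  · exact Or.inl (Or.inr ⟨i, s, by simp [natWeight]⟩)
  · by_cases hij : i = j
    · subst hij
      by_cases hst : s = t
      · subst hst
        right
        simp
      · exfalso
        obtain rfl : t = -s := by
          rcases Int.units_eq_one_or s with rfl | rfl <;>
            rcases Int.units_eq_one_or t with rfl | rfl <;> simp_all
        have h1 := hX.1 (some (i, s)) (some (i, -s))
        simp only [natNeg, neg_neg] at h1
        exact hab (self_eq_neg.mp h1)
    · exact Or.inl (Or.inl ⟨i, j, hij, s, -t, by simp [natWeight, sub_eq_add_neg]⟩)

/-- The diagonal matrix of the coroot of `β`. -/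
def corootMatrix (β : Lattice r) : Matrix (NatIndex r) (NatIndex r) ℂ :=
  Matrix.diagonal fun c => (corootPairing β (natWeight c) : ℂ)

theorem corootMatrix_lie {β γ : Lattice r} (hβ : β ∈ rootsB r)
    {X : Matrix (NatIndex r) (NatIndex r) ℂ} (hX : X ∈ skewHomogeneous γ) :
    ⁅corootMatrix β, X⁆ = (corootPairing β γ : ℂ) • X := by
  ext a b
  rw [Ring.lie_def, Matrix.sub_apply, corootMatrix, Matrix.diagonal_mul, Matrix.mul_diagonal,
    Matrix.smul_apply, smul_eq_mul]
  by_cases h : X a b = 0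
  · simp [h]
  · rw [← hX.2 a b h, sub_eq_add_neg (natWeight a), corootPairing_add hβ, corootPairing_neg hβ]
    push_cast
    ring

/-- The skew matrix `E_{ab} - E_{-b,-a}`. -/
def skewUnit (a b : NatIndex r) : Matrix (NatIndex r) (NatIndex r) ℂ :=
  Matrix.single a b 1 - Matrix.single (natNeg b) (natNeg a) 1

theorem skewUnit_mem (a b : NatIndex r) :
    skewUnit a b ∈ skewHomogeneous (natWeight a - natWeight b) := by
  have hinj : ∀ {c d : NatIndex r}, natNeg c = d ↔ c = natNeg d := fun {c d} =>
    ⟨fun h => by rw [← h, natNeg_natNeg], fun h => by rw [h, natNeg_natNeg]⟩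
  constructor
  · intro c d
    simp only [skewUnit, Matrix.sub_apply, Matrix.single_apply, hinj, natNeg_natNeg, neg_sub]
    congr 1 <;> refine if_congr ?_ rfl rfl <;> tauto
  · intro c d h
    simp only [skewUnit, Matrix.sub_apply, Matrix.single_apply] at h
    by_cases h1 : a = c ∧ b = d
    · rw [h1.1, h1.2]
    · rw [if_neg h1] at h
      by_cases h2 : natNeg b = c ∧ natNeg a = d
      · rw [← h2.1, ← h2.2, natWeight_natNeg, natWeight_natNeg]
        abel
      · simp [h2] at h

theorem single_mul_single (a b c d : NatIndex r) :
    Matrix.single a b (1 : ℂ) * Matrix.single c d 1 = if b = c then Matrix.single a d 1 else 0 := by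
  split_ifs with h
  · rw [h, Matrix.single_mul_single_same, one_mul]
  · exact Matrix.single_mul_single_of_ne _ _ _ _ h _

theorem exists_triple {β : Lattice r} (hβ : β ∈ rootsB r) :
    ∃ e ∈ skewHomogeneous β, ∃ f ∈ skewHomogeneous (-β), ⁅e, f⁆ = corootMatrix β := by
  rcases hβ with ⟨i, j, hij, s, t, rfl⟩ | ⟨i, s, rfl⟩
  · refine ⟨skewUnit (some (i, s)) (some (j, -t)), ?_, skewUnit (some (j, -t)) (some (i, s)), ?_, ?_⟩
    · convert skewUnit_mem _ _ using 1
      simp [natWeight]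
    · convert skewUnit_mem _ _ using 1
      congr 1
      simp only [natWeight, Units.val_neg, neg_smul]
      abel
    · have hroot : (s : ℤ) • eps i + (t : ℤ) • eps j ∈ rootsB r := Or.inl ⟨i, j, hij, s, t, rfl⟩
      have hpair : ∀ v, corootPairing ((s : ℤ) • eps i + (t : ℤ) • eps j) v =
          (s : ℤ) * v i + t * v j := fun v => corootPairing_eq_of_mul hroot <| by
        rcases Int.units_eq_one_or s with rfl | rfl <;>
          rcases Int.units_eq_one_or t with rfl | rfl <;>
          simp [eps, hij, hij.symm] <;> ring
      rw [Ring.lie_def]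
      simp only [skewUnit, natNeg, neg_neg, sub_mul, mul_sub, single_mul_single,
        Option.some.injEq, Prod.mk.injEq, hij, hij.symm, false_and, if_false, if_true,
        sub_zero, zero_sub, sub_neg_eq_add]
      simp only [← Matrix.diagonal_single, Matrix.diagonal_sub,
        Matrix.diagonal_add, corootMatrix]
      congr 1
      funext c
      rcases c with _ | ⟨k, u⟩
      · simp [natWeight, corootPairing_zero]
      · rw [hpair]
        simp only [natWeight, Pi.smul_apply, eps_apply, smul_eq_mul, Pi.single_apply,
          Option.some.injEq, Prod.mk.injEq]
        by_cases hki : k = i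
        · subst hki
          rcases Int.units_eq_one_or s with rfl | rfl <;>
            rcases Int.units_eq_one_or u with rfl | rfl <;> simp [hij, hij.symm]
        · by_cases hkj : k = j
          · subst hkj
            rcases Int.units_eq_one_or t with rfl | rfl <;>
              rcases Int.units_eq_one_or u with rfl | rfl <;> simp [hij, hij.symm]
          · simp [hki, hkj, Ne.symm hki, Ne.symm hkj]
  · have hroot : (s : ℤ) • eps i ∈ rootsB r := Or.inr ⟨i, s, rfl⟩
    have hpair : ∀ v, corootPairing ((s : ℤ) • eps i) v = 2 * (s : ℤ) * v i := fun v =>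
      corootPairing_eq_of_mul hroot <| by
        rcases Int.units_eq_one_or s with rfl | rfl <;> simp [eps]
    refine ⟨skewUnit (some (i, s)) none, ?_, (2 : ℂ) • skewUnit none (some (i, s)),
      Submodule.smul_mem _ _ ?_, ?_⟩
    · convert skewUnit_mem _ _ using 1
      simp [natWeight]
    · convert skewUnit_mem _ _ using 1
      simp [natWeight]
    · rw [lie_smul, Ring.lie_def]
      simp only [skewUnit, natNeg, sub_mul, mul_sub, single_mul_single, reduceCtorEq, if_false,
        if_true, sub_zero, zero_sub, sub_neg_eq_add]
      simp only [← Matrix.diagonal_single, Matrix.diagonal_sub,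
        Matrix.diagonal_add, corootMatrix, ← Matrix.diagonal_smul]
      congr 1
      funext c
      rcases c with _ | ⟨k, u⟩
      · simp [natWeight, corootPairing_zero]
      · rw [hpair]
        simp only [natWeight, Pi.smul_apply, eps_apply, smul_eq_mul, Pi.single_apply,
          Option.some.injEq, Prod.mk.injEq]
        by_cases hki : k = i
        · subst hki
          rcases Int.units_eq_one_or s with rfl | rfl <;>
            rcases Int.units_eq_one_or u with rfl | rfl <;> simp
        · simp [hki, Ne.symm hki]

end Orthogonal

/-! ### Homomorphisms from quotients -/

section Quotient

variable {L L' : Type*} [LieRing L] [LieAlgebra ℂ L] [LieRing L'] [LieAlgebra ℂ L']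

/-- The homomorphism induced on the quotient by an ideal contained in the kernel. -/
def quotientLift (I : LieIdeal ℂ L) (φ : L →ₗ⁅ℂ⁆ L') (h : ∀ x ∈ I, φ x = 0) : L ⧸ I →ₗ⁅ℂ⁆ L' where
  __ := I.toSubmodule.liftQ (φ : L →ₗ[ℂ] L') h
  map_lie' {x y} := by
    induction x using Submodule.Quotient.induction_on
    induction y using Submodule.Quotient.induction_on
    exact φ.map_lie _ _

end Quotient

/-! ### The natural representation of the intersection matrix algebra -/

section Representation

variable {r : ℕ} {ι : Type*} {δ : ι → Lattice r}

theorem pow_ad_mem_skewHomogeneous {γ δ : Lattice r} {X Y : Matrix (NatIndex r) (NatIndex r) ℂ}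
    (hX : X ∈ skewHomogeneous γ) (hY : Y ∈ skewHomogeneous δ) (k : ℕ) :
    (LieAlgebra.ad ℂ _ X ^ k) Y ∈ skewHomogeneous (k • γ + δ) := by
  induction k with
  | zero => simpa using hY
  | succ k ih =>
    rw [pow_succ', Module.End.mul_apply, LieAlgebra.ad_apply, succ_nsmul', add_assoc]
    exact lie_mem_skewHomogeneous hX ih

theorem map_pow_ad {L L' : Type*} [LieRing L] [LieAlgebra ℂ L] [LieRing L'] [LieAlgebra ℂ L']
    (φ : L →ₗ⁅ℂ⁆ L') (x y : L) (k : ℕ) :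
    φ ((LieAlgebra.ad ℂ L x ^ k) y) = (LieAlgebra.ad ℂ L' (φ x) ^ k) (φ y) := by
  induction k with
  | zero => simp
  | succ k ih => simp [pow_succ', ih]

theorem eq_zero_of_three_le {γ : Lattice r} {X : Matrix (NatIndex r) (NatIndex r) ℂ}
    (hX : X ∈ skewHomogeneous γ) (h : 3 ≤ γ ⬝ᵥ γ) : X = 0 := by
  by_contra h0
  rcases mem_of_skewHomogeneous_ne_zero hX h0 with h1 | rfl
  · rcases mem_rootsB_iff.mp h1 with h1 | h1 <;> omega
  · simp at h

theorem norm_add (v w : Lattice r) :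
    (v + w) ⬝ᵥ (v + w) = v ⬝ᵥ v + w ⬝ᵥ w + 2 * (v ⬝ᵥ w) := by
  simp only [add_dotProduct, dotProduct_add, dotProduct_comm w v]
  ring

theorem dotProduct_reflect {a : Lattice r} (ha : a ∈ rootsB r) (v : Lattice r) :
    a ⬝ᵥ reflect a v = -(a ⬝ᵥ v) := by
  have h := corootPairing_mul ha v
  rw [reflect, dotProduct_sub, dotProduct_smul, smul_eq_mul]
  linarith

theorem three_le_norm_of_nonpos {a v : Lattice r} (ha : a ∈ rootsB r)
    (h : 3 ≤ a ⬝ᵥ a + v ⬝ᵥ v) (hav : corootPairing a v ≤ 0) :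
    3 ≤ (((-corootPairing a v).toNat + 1) • a + v) ⬝ᵥ
      (((-corootPairing a v).toNat + 1) • a + v) := by
  have h1 : ((-corootPairing a v).toNat + 1) • a + v = a + reflect a v := by
    rw [← Nat.cast_smul_eq_nsmul ℤ, Nat.cast_add, Int.toNat_of_nonneg (by omega), reflect]
    push_cast
    module
  have h2 : ¬0 < a ⬝ᵥ v := fun h => by
    have := (corootPairing_pos_iff ha).mpr h
    omega
  rw [h1, norm_add, dotProduct_reflect_self ha, dotProduct_reflect ha]
  omega

/-- The images of the generators in the natural representation. -/
def repGenerator (hδ : ∀ i, δ i ∈ rootsB r) :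
    CartanMatrix.Generators ι → Matrix (NatIndex r) (NatIndex r) ℂ
  | .E i => (exists_triple (hδ i)).choose
  | .F i => (exists_triple (hδ i)).choose_spec.2.choose
  | .H i => corootMatrix (δ i)

/-- The natural representation of the free Lie algebra. -/
def freeRep (hδ : ∀ i, δ i ∈ rootsB r) :
    FreeLieAlgebra ℂ (CartanMatrix.Generators ι) →ₗ⁅ℂ⁆ Matrix (NatIndex r) (NatIndex r) ℂ :=
  FreeLieAlgebra.lift ℂ (repGenerator hδ)

theorem freeRep_freeE_mem (hδ : ∀ i, δ i ∈ rootsB r) (i : ι) :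
    freeRep hδ (freeE i) ∈ skewHomogeneous (δ i) := by
  rw [freeRep, FreeLieAlgebra.lift_of_apply]
  exact (exists_triple (hδ i)).choose_spec.1

theorem freeRep_freeF_mem (hδ : ∀ i, δ i ∈ rootsB r) (i : ι) :
    freeRep hδ (freeF i) ∈ skewHomogeneous (-δ i) := by
  rw [freeRep, FreeLieAlgebra.lift_of_apply]
  exact (exists_triple (hδ i)).choose_spec.2.choose_spec.1

theorem freeRep_freeH (hδ : ∀ i, δ i ∈ rootsB r) (i : ι) :
    freeRep hδ (freeH i) = corootMatrix (δ i) := by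
  rw [freeRep, FreeLieAlgebra.lift_of_apply]
  rfl

theorem freeRep_lie (hδ : ∀ i, δ i ∈ rootsB r) (i : ι) :
    ⁅freeRep hδ (freeE i), freeRep hδ (freeF i)⁆ = freeRep hδ (freeH i) := by
  simp only [freeRep, FreeLieAlgebra.lift_of_apply]
  exact (exists_triple (hδ i)).choose_spec.2.choose_spec.2

theorem freeRep_freeH_mem (hδ : ∀ i, δ i ∈ rootsB r) (i : ι) :
    freeRep hδ (freeH i) ∈ skewHomogeneous 0 := by
  rw [← freeRep_lie, ← add_neg_cancel (δ i)]
  exact lie_mem_skewHomogeneous (freeRep_freeE_mem hδ i) (freeRep_freeF_mem hδ i)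

theorem freeRep_relator (hδ : ∀ i, δ i ∈ rootsB r)
    (hshort : ∀ i j, i ≠ j → 3 ≤ δ i ⬝ᵥ δ i + δ j ⬝ᵥ δ j)
    {x : FreeLieAlgebra ℂ (CartanMatrix.Generators ι)}
    (hx : GimRelator (intersectionMatrix δ) x) : freeRep hδ x = 0 := by
  have hM : ∀ i j, intersectionMatrix δ i j = corootPairing (δ i) (δ j) := fun _ _ => rfl
  have hne : ∀ i j, intersectionMatrix δ i j ≤ 0 → i ≠ j := by
    rintro i j h rfl
    rw [hM, corootPairing_self (hδ i)] at h
    omega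
  have hdot : ∀ i j, intersectionMatrix δ i j ≤ 0 → δ i ⬝ᵥ δ j ≤ 0 := fun i j h => by
    by_contra! h1
    have := (corootPairing_pos_iff (hδ i)).mpr h1
    rw [hM] at h
    omega
  have hE := freeRep_freeE_mem hδ
  have hF := freeRep_freeF_mem hδ
  cases hx with
  | he i j =>
    rw [map_sub, map_smul, LieHom.map_lie, freeRep_freeH, corootMatrix_lie (hδ i) (hE j), hM,
      sub_self]
  | hf i j =>
    rw [map_add, map_smul, LieHom.map_lie, freeRep_freeH, corootMatrix_lie (hδ i) (hF j), hM,
      corootPairing_neg (hδ i), Int.cast_neg, neg_smul, neg_add_cancel]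
  | ef i => rw [map_sub, LieHom.map_lie, freeRep_lie, sub_self]
  | nonpos_ef i j h =>
    rw [LieHom.map_lie]
    refine eq_zero_of_three_le (lie_mem_skewHomogeneous (hE i) (hF j)) ?_
    have := hshort i j (hne i j h)
    have := hdot i j h
    rw [norm_add]
    simp only [neg_dotProduct, dotProduct_neg, neg_neg]
    omega
  | nonpos_fe i j h =>
    rw [LieHom.map_lie]
    refine eq_zero_of_three_le (lie_mem_skewHomogeneous (hF i) (hE j)) ?_
    have := hshort i j (hne i j h)
    have := hdot i j h
    rw [norm_add]
    simp only [neg_dotProduct, dotProduct_neg, neg_neg]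
    omega
  | nonpos_ad_e i j h =>
    rw [map_pow_ad]
    exact eq_zero_of_three_le (pow_ad_mem_skewHomogeneous (hE i) (hE j) _)
      (three_le_norm_of_nonpos (hδ i) (hshort i j (hne i j h)) h)
  | nonpos_ad_f i j h =>
    rw [map_pow_ad]
    refine eq_zero_of_three_le (pow_ad_mem_skewHomogeneous (hF i) (hF j) _) ?_
    have h1 : corootPairing (-δ i) (-δ j) = corootPairing (δ i) (δ j) := by
      rw [corootPairing_neg_left (hδ i), corootPairing_neg (hδ i), neg_neg]
    have h2 := three_le_norm_of_nonpos (neg_mem_rootsB (hδ i)) (v := -δ j)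
      (by simpa using hshort i j (hne i j h)) (by rw [h1]; exact h)
    rwa [h1] at h2
  | pos_ee i j h hij =>
    rw [LieHom.map_lie]
    refine eq_zero_of_three_le (lie_mem_skewHomogeneous (hE i) (hE j)) ?_
    have := hshort i j hij
    have := (corootPairing_pos_iff (hδ i)).mp h
    rw [norm_add]
    omega
  | pos_ff i j h hij =>
    rw [LieHom.map_lie]
    refine eq_zero_of_three_le (lie_mem_skewHomogeneous (hF i) (hF j)) ?_
    have := hshort i j hij
    have := (corootPairing_pos_iff (hδ i)).mp h
    rw [norm_add]
    simp only [neg_dotProduct, dotProduct_neg, neg_neg]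
    omega
  | pos_ad_e i j h hij =>
    rw [map_pow_ad]
    refine eq_zero_of_three_le (pow_ad_mem_skewHomogeneous (hE i) (hF j) _) ?_
    have h1 : -corootPairing (δ i) (-δ j) = corootPairing (δ i) (δ j) := by
      rw [corootPairing_neg (hδ i), neg_neg]
    rw [hM] at h
    have h2 := three_le_norm_of_nonpos (hδ i) (v := -δ j) (by simpa using hshort i j hij)
      (by omega)
    rwa [h1] at h2
  | pos_ad_f i j h hij =>
    rw [map_pow_ad]
    refine eq_zero_of_three_le (pow_ad_mem_skewHomogeneous (hF i) (hE j) _) ?_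
    have h1 : -corootPairing (-δ i) (δ j) = corootPairing (δ i) (δ j) := by
      rw [corootPairing_neg_left (hδ i), neg_neg]
    rw [hM] at h
    have h2 := three_le_norm_of_nonpos (neg_mem_rootsB (hδ i)) (v := δ j)
      (by simpa using hshort i j hij) (by omega)
    rwa [h1] at h2

/-- The natural representation of `gim`. -/
def gimRep (hδ : ∀ i, δ i ∈ rootsB r)
    (hshort : ∀ i j, i ≠ j → 3 ≤ δ i ⬝ᵥ δ i + δ j ⬝ᵥ δ j) :
    Gim (intersectionMatrix δ) →ₗ⁅ℂ⁆ Matrix (NatIndex r) (NatIndex r) ℂ :=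
  quotientLift _ (freeRep hδ) fun x hx => by
    have : gimIdeal (intersectionMatrix δ) ≤ (freeRep hδ).ker :=
      LieSubmodule.lieSpan_le.mpr fun y hy => (LieHom.mem_ker).mpr (freeRep_relator hδ hshort hy)
    exact (LieHom.mem_ker).mp (this hx)

theorem gimRep_mem (hδ : ∀ i, δ i ∈ rootsB r)
    (hshort : ∀ i j, i ≠ j → 3 ≤ δ i ⬝ᵥ δ i + δ j ⬝ᵥ δ j) {γ : Lattice r}
    {x : Gim (intersectionMatrix δ)} (hx : HasDegree δ γ x) :
    gimRep hδ hshort x ∈ skewHomogeneous γ := by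
  induction hx with
  | e i => exact freeRep_freeE_mem hδ i
  | f i => exact freeRep_freeF_mem hδ i
  | h i => exact freeRep_freeH_mem hδ i
  | zero γ => rw [map_zero]; exact zero_mem _
  | add _ _ hx hy => rw [map_add]; exact add_mem hx hy
  | smul c _ hx => rw [map_smul]; exact Submodule.smul_mem _ c hx
  | lie _ _ hx hy => rw [LieHom.map_lie]; exact lie_mem_skewHomogeneous hx hy

theorem gimE_notMem_radical (hδ : ∀ i, δ i ∈ rootsB r)
    (hshort : ∀ i j, i ≠ j → 3 ≤ δ i ⬝ᵥ δ i + δ j ⬝ᵥ δ j) (i : ι) :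
    gimE (intersectionMatrix δ) i ∉ radical δ := by
  intro h
  have hle : radical δ ≤ (gimRep hδ hshort).ker := LieSubmodule.lieSpan_le.mpr fun x hx => by
    obtain ⟨γ, hγ, hx⟩ := hx
    refine (LieHom.mem_ker).mpr ?_
    by_contra h0
    exact hγ (Set.union_subset_union_left _ rootsB_subset_rootsBC
      (mem_of_skewHomogeneous_ne_zero (gimRep_mem hδ hshort hx) h0))
  have h1 : freeRep hδ (freeE i) = 0 := (LieHom.mem_ker).mp (hle h)
  have h2 : corootMatrix (δ i) = 0 := by rw [← freeRep_freeH hδ, ← freeRep_lie, h1, zero_lie]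
  refine ne_zero_of_mem_rootsB (hδ i) (funext fun k => ?_)
  have h3 := congrFun (congrFun h2 (some (k, 1))) (some (k, 1))
  simp only [corootMatrix, Matrix.diagonal_apply_eq, natWeight, Units.val_one, one_smul,
    Matrix.zero_apply, Int.cast_eq_zero] at h3
  rwa [corootPairing_eq_zero_iff (hδ i), dotProduct_eps] at h3

end Representation

/-! ### The grading of the intersection matrix algebra -/

section ImGrading

variable {r : ℕ} {ι : Type*} {δ : ι → Lattice r}

theorem gim_mk_eq_zero {M : Matrix ι ι ℤ} {x : FreeLieAlgebra ℂ (CartanMatrix.Generators ι)}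
    (hx : GimRelator M x) : (LieSubmodule.Quotient.mk x : Gim M) = 0 :=
  LieSubmodule.Quotient.mk_eq_zero'.mpr (LieSubmodule.subset_lieSpan hx)

theorem gimH_lie_gimE (M : Matrix ι ι ℤ) (i j : ι) :
    ⁅gimH M i, gimE M j⁆ = (M i j : ℂ) • gimE M j :=
  sub_eq_zero.mp (gim_mk_eq_zero (GimRelator.he i j))

theorem gimH_lie_gimF (M : Matrix ι ι ℤ) (i j : ι) :
    ⁅gimH M i, gimF M j⁆ = -((M i j : ℂ) • gimF M j) :=
  eq_neg_of_add_eq_zero_left (gim_mk_eq_zero (GimRelator.hf i j))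

theorem gimE_lie_gimF (M : Matrix ι ι ℤ) (i : ι) : ⁅gimE M i, gimF M i⁆ = gimH M i :=
  sub_eq_zero.mp (gim_mk_eq_zero (GimRelator.ef i))

theorem gimH_lie (hδ : ∀ i, δ i ∈ rootsB r) (i : ι) {γ : Lattice r}
    {x : Gim (intersectionMatrix δ)} (hx : HasDegree δ γ x) :
    ⁅gimH (intersectionMatrix δ) i, x⁆ = (corootPairing (δ i) γ : ℂ) • x := by
  have hM : ∀ i j, intersectionMatrix δ i j = corootPairing (δ i) (δ j) := fun _ _ => rfl
  induction hx with
  | e j => exact gimH_lie_gimE _ i j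
  | f j =>
    rw [gimH_lie_gimF, hM, corootPairing_neg (hδ i), Int.cast_neg, neg_smul]
  | h j =>
    rw [← gimE_lie_gimF _ j, leibniz_lie, gimH_lie_gimE, gimH_lie_gimF, smul_lie, lie_neg, lie_smul,
      add_neg_cancel, corootPairing_zero, Int.cast_zero, zero_smul]
  | zero γ => rw [lie_zero, smul_zero]
  | add _ _ hx hy => rw [lie_add, hx, hy, smul_add]
  | smul c _ hx => rw [lie_smul, hx, smul_comm]
  | lie _ _ hx hy =>
    rw [leibniz_lie, hx, hy, smul_lie, lie_smul, ← add_smul, corootPairing_add (hδ i)]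
    push_cast
    rfl

variable (δ) in
/-- The homogeneous components of `im`. -/
def imComponent (γ : Lattice r) : Submodule ℂ (Im δ) :=
  (gimRootSpace δ γ).map (radical δ).toSubmodule.mkQ

variable (δ) in
/-- The projection of the free Lie algebra to `im`. -/
def freeToIm : FreeLieAlgebra ℂ (CartanMatrix.Generators ι) →ₗ⁅ℂ⁆ Im δ where
  __ := (radical δ).toSubmodule.mkQ ∘ₗ (gimIdeal (intersectionMatrix δ)).toSubmodule.mkQ
  map_lie' := rfl

theorem freeToIm_surjective : Function.Surjective (freeToIm δ) :=
  (Submodule.mkQ_surjective _).comp (Submodule.mkQ_surjective _)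

theorem freeToIm_mem {K : LieSubalgebra ℂ (Im δ)}
    (hK : ∀ g : CartanMatrix.Generators ι, freeToIm δ (FreeLieAlgebra.of ℂ g) ∈ K)
    (x : FreeLieAlgebra ℂ (CartanMatrix.Generators ι)) : freeToIm δ x ∈ K := by
  have h : K.incl.comp (FreeLieAlgebra.lift ℂ fun g =>
      (⟨freeToIm δ (FreeLieAlgebra.of ℂ g), hK g⟩ : K)) = freeToIm δ :=
    FreeLieAlgebra.hom_ext fun g => by simp
  rw [← h]
  exact Subtype.property _

theorem lieSpan_imComponent (hδ : ∀ i, δ i ∈ rootsB r) :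
    LieSubalgebra.lieSpan ℂ (Im δ) {x | ∃ γ ∈ rootsBC r, x ∈ imComponent δ γ} = ⊤ := by
  set K := LieSubalgebra.lieSpan ℂ (Im δ) {x | ∃ γ ∈ rootsBC r, x ∈ imComponent δ γ} with hKdef
  have hE : ∀ i, freeToIm δ (freeE i) ∈ K := fun i => LieSubalgebra.subset_lieSpan
    ⟨δ i, rootsB_subset_rootsBC (hδ i), gimE _ i, HasDegree.e i, rfl⟩
  have hF : ∀ i, freeToIm δ (freeF i) ∈ K := fun i => LieSubalgebra.subset_lieSpan
    ⟨-δ i, rootsB_subset_rootsBC (neg_mem_rootsB (hδ i)), gimF _ i, HasDegree.f i, rfl⟩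
  refine eq_top_iff.mpr fun x _ => ?_
  obtain ⟨y, rfl⟩ := freeToIm_surjective x
  refine freeToIm_mem (fun g => ?_) y
  cases g with
  | E i => exact hE i
  | F i => exact hF i
  | H i =>
    have h1 : freeToIm δ (freeH i) = ⁅freeToIm δ (freeE i), freeToIm δ (freeF i)⁆ :=
      (congrArg (LieSubmodule.Quotient.mk (N := radical δ)) (gimE_lie_gimF _ i)).symm
    exact h1 ▸ K.lie_mem (hE i) (hF i)

/-- The grading of `im` with the triples attached to a subfamily of the roots. -/
def imGrading (hδ : ∀ i, δ i ∈ rootsB r)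
    (hshort : ∀ i j, i ≠ j → 3 ≤ δ i ⬝ᵥ δ i + δ j ⬝ᵥ δ j) (s : Fin r → ι) :
    TripleGrading (fun i => δ (s i)) (Im δ) where
  G := imComponent δ
  e i := LieSubmodule.Quotient.mk (gimE _ (s i))
  f i := LieSubmodule.Quotient.mk (gimF _ (s i))
  h i := LieSubmodule.Quotient.mk (gimH _ (s i))
  e_mem i := ⟨_, HasDegree.e (s i), rfl⟩
  f_mem i := ⟨_, HasDegree.f (s i), rfl⟩
  lie_mem := by
    rintro γ γ' _ ⟨x, hx, rfl⟩ _ ⟨y, hy, rfl⟩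
    exact ⟨⁅x, y⁆, HasDegree.lie hx hy, rfl⟩
  eq_bot γ hγ := by
    refine (Submodule.eq_bot_iff _).mpr ?_
    rintro _ ⟨x, hx, rfl⟩
    exact LieSubmodule.Quotient.mk_eq_zero'.mpr (LieSubmodule.subset_lieSpan ⟨γ, hγ, hx⟩)
  lie_e_f i := congrArg (LieSubmodule.Quotient.mk (N := radical δ)) (gimE_lie_gimF _ (s i))
  lie_h i γ := by
    rintro _ ⟨x, hx, rfl⟩
    exact congrArg (LieSubmodule.Quotient.mk (N := radical δ)) (gimH_lie hδ (s i) hx)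
  lieSpan_eq_top := lieSpan_imComponent hδ
  e_ne_zero i h := gimE_notMem_radical hδ hshort (s i) (LieSubmodule.Quotient.mk_eq_zero'.mp h)

end ImGrading

end IMAlg

end

theorem proposition1 (r d : ℕ) (hr : 3 ≤ r)
    (α : Fin r → IMAlg.Lattice r) (hα : IMAlg.IsBaseB α)
    (β : Fin d → IMAlg.Lattice r) (hβ : ∀ k, β k ∈ IMAlg.longRoots r) :
    IMAlg.IsBCGraded r (IMAlg.Im (Sum.elim α β)) := by
  have hδ : ∀ i, Sum.elim α β i ∈ IMAlg.rootsB r := by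
    rintro (i | k)
    exacts [hα.mem i, Or.inl (hβ k)]
  have hlong : ∀ k, β k ⬝ᵥ β k = 2 := by
    intro k
    obtain ⟨i, j, hij, s, t, h⟩ := hβ k
    rw [h]
    rcases Int.units_eq_one_or s with rfl | rfl <;>
      rcases Int.units_eq_one_or t with rfl | rfl <;> simp [IMAlg.eps, hij, hij.symm]
  have hpos := fun i => IMAlg.dotProduct_self_pos (hδ i)
  have hshort : ∀ i j, i ≠ j →
      3 ≤ Sum.elim α β i ⬝ᵥ Sum.elim α β i + Sum.elim α β j ⬝ᵥ Sum.elim α β j := by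
    rintro (i | k) (j | l) hij
    · exact hα.three_le_norm_add_norm fun h => hij (congrArg _ h)
    · have := hpos (Sum.inl i)
      have := hlong l
      simp only [Sum.elim_inl, Sum.elim_inr] at *
      omega
    · have := hpos (Sum.inl j)
      have := hlong k
      simp only [Sum.elim_inl, Sum.elim_inr] at *
      omega
    · have := hlong k
      have := hlong l
      simp only [Sum.elim_inr] at *
      omega
  have : Nonempty (Fin r) := ⟨⟨0, by omega⟩⟩
  exact (IMAlg.imGrading hδ hshort Sum.inl).isBCGraded hα
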